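/- There is a universal constant $C>0$ such that the following holds. Let $d,n,K,M,r$ be natural numbers with $1\le r\le M\le K$ and $nK\ge 2$, let $\theta\in(0,1]$, $\sigma>0$ and $a_1,\dots,a_M\in\mathbb R^d$. For each $m\in\{1,\dots,M\}$ let $\nu_m$ be a probability distribution of $(X,Y)$ on $\mathbb R^d\times\{-1,+1\}$ such that, under $\nu_m$, $\|X-a_m\|$ has the folded Gaussian distribution with parameter $\sigma^2$, i.e. the law of $|U|$ with $U\sim\mathcal N(0,\sigma^2)$ (so the data have unbounded support). ($r$-th setup.) For $k\in\{1,\dots,K\}$ put $c_k=(k \bmod (M-r+1))+1$. Let client $k$ have the data distribution $$\mu_k=\sum_{m=c_k}^{c_k+r-1}\alpha_{k,m}\,\nu_m ,$$ where the $\alpha_{k,m}\ge 0$ are arbitrary weights with $\sum_{m=c_k}^{c_k+r-1}\alpha_{k,m}=1$ for every $k$. (Any additional balancing conditions across the clients are allowed but not needed.) (Distributed SVM.) Independently of the other clients, client $k$ draws a training set $S_k=(Z_{k,1},\dots,Z_{k,n})\sim\mu_k^{\otimes n}$, $Z_{k,i}=(X_{k,i},Y_{k,i})$, and applies to it its own,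 possibly randomized, learning algorithm, which returns a linear classifier $W_k\in\mathbb R^d$ with $\|W_k\|\le 1$. The aggregated model is $\overline W=\frac1K\sum_{k=1}^K W_k$. With $\ell_\theta((x,y),w)=\mathbb 1\{y\langle x,w\rangle<\theta\}$ and $\ell_0((x,y),w)=\mathbb 1\{y\langle x,w\rangle<0\}$, the margin generalization error is $$\mathrm{gen}_\theta(S_{[K]},\overline W)=\frac1K\sum_{k=1}^K\Big(\mathbb E_{Z\sim\mu_k}[\ell_0(Z,\overline W)]-\frac1n\sum_{i=1}^n\ell_\theta(Z_{k,i},\overline W)\Big).$$ Then $\mathrm{gen}_\theta(S_{[K]},\overline W)$ is integrable and $$\mathbb E\big[\mathrm{gen}_\theta(S_{[K]},\overline W)\big]\le C\sqrt{\frac1{nK}\sum_{k=1}^K\left[\Big(\frac{\rho_k}{K\theta}\Big)^2\log\Big(\max\big(3,\tfrac{K\theta}{\sigma}\big)\Big)\log(nK)+\log\Big(\max\big(1,\tfrac{4n\|b_k\|}{K\theta}\big)\Big)\right]},$$ where $\rho_k=D_{k,r}+\sigma\sqrt{\log(nK)}$, $D_{k,r}=\max_{c_k\le i,j\le c_k+r-1}\|a_i-a_j\|$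 and $b_k=\sum_{m=c_k}^{c_k+r-1}\alpha_{k,m}a_m$. -/

import Mathlib

open MeasureTheory ProbabilityTheory
open scoped NNReal ENNReal

namespace DSVM

noncomputable section

/-- The feature space `ℝ^d` with its Euclidean norm. It is also the space of (homogeneous) linear
classifiers. -/
abbrev Feature (d : ℕ) : Type := EuclideanSpace ℝ (Fin d)

/-- A labelled sample `z = (x, y)` with `x ∈ ℝ^d` and `y ∈ {-1, +1}` (the units of `ℤ`). -/
abbrev Sample (d : ℕ) : Type := Feature d × ℤˣ

/-- The law of `|U|` for `U ∼ 𝒩(0, v)`. -/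
def foldedGaussian (v : ℝ≥0) : Measure ℝ :=
  (gaussianReal 0 v).map (fun u => |u|)

/-- The `0`-`1` loss with margin `θ` of the linear classifier `w`:
`1` if `y ⟪x, w⟫ < θ` and `0` otherwise. For `θ = 0` it is the plain `0`-`1` loss. -/
def marginLoss {d : ℕ} (θ : ℝ) (z : Sample d) (w : Feature d) : ℝ :=
  if ((z.2 : ℤ) : ℝ) * inner ℝ z.1 w < θ then 1 else 0

/-- The population risk `𝔼_{Z ∼ μ} [ℓ₀(Z, w)]`. -/
def popRisk {d : ℕ} (μ : Measure (Sample d)) (w : Feature d) : ℝ :=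
  ∫ z, marginLoss 0 z w ∂μ

/-- The empirical margin risk `(1/n) ∑ᵢ ℓ_θ(zᵢ, w)`. -/
def empRisk {d n : ℕ} (θ : ℝ) (s : Fin n → Sample d) (w : Feature d) : ℝ :=
  (1 / (n : ℝ)) * ∑ i, marginLoss θ (s i) w

/-- What one client contributes: its training set and the classifier it learned from it. -/
abbrev ClientOutcome (d n : ℕ) : Type := (Fin n → Sample d) × Feature d

/-- The aggregated classifier `(1/K) ∑ₖ wₖ`. -/
def aggregate {d n K : ℕ} (ω : Fin K → ClientOutcome d n) : Feature d :=
  (1 / (K : ℝ)) • ∑ k, (ω k).2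

/-- The margin generalization error of the aggregated classifier, averaged over the clients. -/
def genError {d n K : ℕ} (θ : ℝ) (μ : Fin K → Measure (Sample d))
    (ω : Fin K → ClientOutcome d n) : ℝ :=
  (1 / (K : ℝ)) * ∑ k, (popRisk (μ k) (aggregate ω) - empRisk θ (ω k).1 (aggregate ω))

/-- The joint law of all training sets and all local classifiers: client `k` draws `n` i.i.d.
samples from `μ k` and applies its own (possibly randomized) algorithm `A k` to them,
independently of the other clients. -/
def jointLaw {d n K : ℕ} (μ : Fin K → Measure (Sample d))
    (A : Fin K → Kernel (Fin n → Sample d) (Feature d)) :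
    Measure (Fin K → ClientOutcome d n) :=
  Measure.pi fun k => (Measure.pi fun _ : Fin n => μ k) ⊗ₘ A k

/-- The expected margin generalization error. -/
def expectedGenError {d n K : ℕ} (θ : ℝ) (μ : Fin K → Measure (Sample d))
    (A : Fin K → Kernel (Fin n → Sample d) (Feature d)) : ℝ :=
  ∫ ω, genError θ μ ω ∂(jointLaw μ A)

/-- The first index `c_k = (k mod (M - r + 1)) + 1` of the window of client `k` in the `r`-th
setup. Clients and components are numbered from `1` in this formula, hence `k + 1` here. -/
def windowStart (M r : ℕ) {K : ℕ} (k : Fin K) : ℕ :=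
  ((k : ℕ) + 1) % (M - r + 1) + 1

/-- The window `{c_k, …, c_k + r - 1}` of components of client `k`; the component `m : Fin M`
has number `m + 1`. -/
def window (M r : ℕ) {K : ℕ} (k : Fin K) : Finset (Fin M) :=
  Finset.univ.filter fun m =>
    windowStart M r k ≤ (m : ℕ) + 1 ∧ (m : ℕ) + 1 ≤ windowStart M r k + r - 1

/-- The data distribution `∑_{m = c_k}^{c_k + r - 1} α_{k,m} ν_m` of client `k`. -/
def clientLaw {d M K : ℕ} (r : ℕ) (α : Fin K → Fin M → ℝ≥0)
    (ν : Fin M → Measure (Sample d)) (k : Fin K) : Measure (Sample d) :=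
  ∑ m ∈ window M r k, α k m • ν m

/-- The barycentre `b_k = ∑_{m = c_k}^{c_k + r - 1} α_{k,m} a_m`. -/
def barycentre {d M K : ℕ} (r : ℕ) (α : Fin K → Fin M → ℝ≥0)
    (a : Fin M → Feature d) (k : Fin K) : Feature d :=
  ∑ m ∈ window M r k, (α k m : ℝ) • a m

/-- `D_{k,r}`, the maximum of `‖a_i - a_j‖` over all `i, j` in the window of client `k`. -/
def spread {d M K : ℕ} (r : ℕ) (a : Fin M → Feature d) (k : Fin K) : ℝ :=
  ((window M r k ×ˢ window M r k).sup fun p => ‖a p.1 - a p.2‖₊ : ℝ≥0)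

/-- `ρ_k = D_{k,r} + σ √(log (nK))`. -/
def effRadius {d M K : ℕ} (n r : ℕ) (a : Fin M → Feature d) (σ : ℝ) (k : Fin K) : ℝ :=
  spread r a k + σ * Real.sqrt (Real.log ((n : ℝ) * K))

end

end DSVM

/-! Fix one client and freeze the others. If `v` is the sum of their classifiers, the aggregate is
`(w + v) / K`, and only `w` depends on the client's sample. A deviation bound that is uniform over
`‖w‖ ≤ 1` and the same for every `v` therefore controls the client, whatever its algorithm
(`integral_clientError_le`).

Let `b` be the barycentre. The score `y ⟪x, w + v⟫ / K` splits into `y ⟪x - b, w⟫ / K`, a term `y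
⟪x, v⟫ / K` free of `w`, and `y ⟪b, w⟫ / K`. The last one sees `w` only through a scalar in `[-‖b‖ /
K, ‖b‖ / K]`. Rounding that scalar to a grid of step `θ / 3` moves the score by at most `θ / 3`, and
a ramp falling from `1` at `θ / 3` to `0` at `2 θ / 3` then fits between the two losses. A distant
centre thus costs only the logarithm of the number `N` of grid points.

Symmetrization (`integral_deviation_le`) leads to a Rademacher average of ramps. For one grid point,
contraction (`signAvg_iSup_le_of_contraction`) leaves a linear class, bounded by `3 / θ` times the
root of the sum of squared centred norms. The maximum over the grid adds `√(2 n log N)` by bounded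
differences (`signAvg_le_of_forall_le`). These meet in `rademacher_lipschitz_le` and
`exists_uniform_bound`.

The folded Gaussian enters only through its second moment: the centred features have second moment
at most `2 (σ² + D²)`, which `ρ_k²` and the logarithms dominate since `log (n K) ≥ 1 / 2` and the
other logarithm is at least `1`. Cauchy–Schwarz then averages over the clients. -/

namespace DSVM

/-! ### Averages over the sign cube -/

/-- The average of a function over all sign vectors of length `n`. -/
noncomputable def signAvg {n : ℕ} (F : (Fin n → ℤˣ) → ℝ) : ℝ := (∑ ε, F ε) / 2 ^ n

/-- The real value of a sign. -/
def sgn (e : ℤˣ) : ℝ := ((e : ℤ) : ℝ)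

@[simp] lemma sgn_one : sgn 1 = 1 := by simp [sgn]

@[simp] lemma sgn_neg_one : sgn (-1) = -1 := by simp [sgn]

lemma sgn_eq_or (e : ℤˣ) : sgn e = 1 ∨ sgn e = -1 := by
  rcases Int.units_eq_one_or e with rfl | rfl <;> simp

@[simp] lemma abs_sgn (e : ℤˣ) : |sgn e| = 1 := by
  rcases sgn_eq_or e with h | h <;> simp [h]

lemma signAvg_zero (F : (Fin 0 → ℤˣ) → ℝ) : signAvg F = F default := by
  simp only [signAvg, pow_zero, div_one]
  exact (Fintype.sum_unique F).trans (congrArg F (Subsingleton.elim _ _))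

lemma signAvg_succ {n : ℕ} (F : (Fin (n + 1) → ℤˣ) → ℝ) :
    signAvg F = signAvg fun ε => (F (Fin.cons 1 ε) + F (Fin.cons (-1) ε)) / 2 := by
  have h : ∑ ε, F ε = ∑ p : ℤˣ × (Fin n → ℤˣ), F (Fin.cons p.1 p.2) :=
    (Fintype.sum_equiv (Fin.consEquiv fun _ : Fin (n + 1) => ℤˣ) _ _ fun _ => rfl).symm
  have h2 : (Finset.univ : Finset ℤˣ) = {1, -1} := rfl
  rw [signAvg, signAvg, h, Fintype.sum_prod_type, h2, Finset.sum_pair (by decide),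
    ← Finset.sum_add_distrib, ← Finset.sum_div, pow_succ]
  field_simp

lemma signAvg_mono {n : ℕ} {F G : (Fin n → ℤˣ) → ℝ} (h : ∀ ε, F ε ≤ G ε) :
    signAvg F ≤ signAvg G := by
  unfold signAvg
  gcongr with ε
  exact h ε

lemma signAvg_add {n : ℕ} (F G : (Fin n → ℤˣ) → ℝ) :
    signAvg (fun ε => F ε + G ε) = signAvg F + signAvg G := by
  simp [signAvg, Finset.sum_add_distrib, add_div]

lemma signAvg_div {n : ℕ} (F : (Fin n → ℤˣ) → ℝ) (c : ℝ) :
    signAvg (fun ε => F ε / c) = signAvg F / c := by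
  simp only [signAvg, ← Finset.sum_div]
  ring

lemma signAvg_mul_left {n : ℕ} (F : (Fin n → ℤˣ) → ℝ) (c : ℝ) :
    signAvg (fun ε => c * F ε) = c * signAvg F := by
  simp only [signAvg, ← Finset.mul_sum]
  ring

@[simp] lemma signAvg_const {n : ℕ} (c : ℝ) : signAvg (fun _ : Fin n → ℤˣ => c) = c := by
  simp [signAvg]

lemma signAvg_neg {n : ℕ} (F : (Fin n → ℤˣ) → ℝ) :
    signAvg (fun ε => F (-ε)) = signAvg F := by
  unfold signAvg
  congr 1
  exact Fintype.sum_equiv (Equiv.neg _) _ _ fun _ => rfl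

lemma signAvg_sum {n : ℕ} {J : Type*} (s : Finset J) (F : J → (Fin n → ℤˣ) → ℝ) :
    signAvg (fun ε => ∑ j ∈ s, F j ε) = ∑ j ∈ s, signAvg (F j) := by
  simp only [signAvg]
  rw [Finset.sum_comm, Finset.sum_div]

/-- Jensen's inequality, from the tangent line of `exp` at the mean. -/
lemma exp_signAvg_le {n : ℕ} (F : (Fin n → ℤˣ) → ℝ) :
    Real.exp (signAvg F) ≤ signAvg fun ε => Real.exp (F ε) := by
  have h := signAvg_mono (n := n) (F := fun ε => Real.exp (signAvg F) * (F ε - signAvg F + 1))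
    (G := fun ε => Real.exp (F ε)) fun ε => by
      have := Real.add_one_le_exp (F ε - signAvg F)
      calc _ ≤ Real.exp (signAvg F) * Real.exp (F ε - signAvg F) := by gcongr
        _ = _ := by rw [← Real.exp_add]; ring_nf
  have h2 : signAvg (fun ε => F ε - signAvg F + 1) = 1 := by
    have h3 := signAvg_add F (fun _ => 1 - signAvg F)
    rw [signAvg_const] at h3
    calc _ = signAvg (fun ε => F ε + (1 - signAvg F)) := by congr 1; ext; ring
      _ = 1 := by rw [h3]; ring
  rwa [signAvg_mul_left, h2, mul_one] at h

/-- Exponential moment bound for functions with bounded differences on the sign cube. -/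
lemma signAvg_exp_le (l : ℝ) : ∀ {n : ℕ} (F : (Fin n → ℤˣ) → ℝ),
    (∀ ε ε' i, (∀ j, j ≠ i → ε j = ε' j) → |F ε - F ε'| ≤ 2) →
    signAvg (fun ε => Real.exp (l * F ε)) ≤ Real.exp (l * signAvg F + n * l ^ 2 / 2)
  | 0, F, _ => by simp [signAvg_zero]
  | n + 1, F, hF => by
    rw [signAvg_succ, signAvg_succ F]
    -- Averaging out the first sign preserves bounded differences, so the induction runs on `M`.
    set M : (Fin n → ℤˣ) → ℝ := fun ε => (F (Fin.cons 1 ε) + F (Fin.cons (-1) ε)) / 2 with hM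
    have hMd : ∀ ε ε' i, (∀ j, j ≠ i → ε j = ε' j) → |M ε - M ε'| ≤ 2 := by
      intro ε ε' i h
      have h1 : ∀ e : ℤˣ, |F (Fin.cons e ε) - F (Fin.cons e ε')| ≤ 2 := fun e =>
        hF _ _ i.succ fun j => by
          refine Fin.cases (fun _ => rfl) (fun j hj => ?_) j
          simpa using h j (fun hji => hj (by rw [hji]))
      have h2 := abs_le.1 (h1 1)
      have h3 := abs_le.1 (h1 (-1))
      rw [abs_le, hM]
      constructor <;> dsimp only <;> linarith [h2.1, h2.2, h3.1, h3.2]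
    have hstep : ∀ ε, (Real.exp (l * F (Fin.cons 1 ε)) + Real.exp (l * F (Fin.cons (-1) ε))) / 2
        ≤ Real.exp (l ^ 2 / 2) * Real.exp (l * M ε) := by
      intro ε
      -- The two values are `M ε ± D` with `|D| ≤ 1`, so the exponentials average to `exp (l M) cosh
      -- (l D)`, and `cosh x ≤ exp (x ^ 2 / 2)`.
      set D := (F (Fin.cons 1 ε) - F (Fin.cons (-1) ε)) / 2 with hD
      have hD1 : D ^ 2 ≤ 1 := by
        have := hF (Fin.cons 1 ε) (Fin.cons (-1) ε) 0 fun j => by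
          refine Fin.cases (fun h => absurd rfl h) (fun j _ => by simp) j
        rw [sq_le_one_iff_abs_le_one, hD, abs_div, abs_two]
        linarith
      have e1 : l * F (Fin.cons 1 ε) = l * M ε + l * D := by simp only [hM, hD]; ring
      have e2 : l * F (Fin.cons (-1) ε) = l * M ε + -(l * D) := by simp only [hM, hD]; ring
      rw [e1, e2, Real.exp_add, Real.exp_add, ← mul_add, mul_div_assoc, ← Real.cosh_eq, mul_comm]
      gcongr
      refine (Real.cosh_le_exp_half_sq _).trans (Real.exp_le_exp.2 ?_)
      nlinarith [sq_nonneg l]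
    refine (signAvg_mono hstep).trans ?_
    rw [signAvg_mul_left]
    refine (mul_le_mul_of_nonneg_left (signAvg_exp_le l M hMd) (Real.exp_pos _).le).trans ?_
    rw [← Real.exp_add]
    apply Real.exp_le_exp.2
    push_cast
    linarith

/-- The average over the sign cube of a maximum of finitely many functions with bounded
differences. -/
lemma signAvg_le_of_forall_le {n : ℕ} {J : Type*} [Fintype J] [Nonempty J]
    (F : J → (Fin n → ℤˣ) → ℝ) (G : (Fin n → ℤˣ) → ℝ) (m : ℝ)
    (hF : ∀ j ε ε' i, (∀ k, k ≠ i → ε k = ε' k) → |F j ε - F j ε'| ≤ 2)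
    (hm : ∀ j, signAvg (F j) ≤ m) (hG : ∀ ε, ∃ j, G ε ≤ F j ε) :
    signAvg G ≤ m + Real.sqrt (2 * n * Real.log (Fintype.card J)) := by
  have hN : (1 : ℝ) ≤ Fintype.card J := by exact_mod_cast Fintype.card_pos
  -- Jensen's inequality, then the largest exponential is at most the sum of all of them.
  have key : ∀ l : ℝ, 0 < l → l * signAvg G ≤ Real.log (Fintype.card J) + l * m + n * l ^ 2 / 2 := by
    intro l hl
    rw [← Real.exp_le_exp, add_assoc, Real.exp_add, Real.exp_log (by linarith)]
    rw [← signAvg_mul_left]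
    refine (exp_signAvg_le _).trans ?_
    calc signAvg (fun ε => Real.exp (l * G ε))
        ≤ signAvg (fun ε => ∑ j, Real.exp (l * F j ε)) := signAvg_mono fun ε => by
          obtain ⟨j, hj⟩ := hG ε
          refine le_trans ?_ (Finset.single_le_sum (f := fun j => Real.exp (l * F j ε))
            (fun _ _ => (Real.exp_pos _).le) (Finset.mem_univ j))
          gcongr
      _ = ∑ j, signAvg (fun ε => Real.exp (l * F j ε)) := signAvg_sum _ _
      _ ≤ ∑ _j : J, Real.exp (l * m + n * l ^ 2 / 2) := Finset.sum_le_sum fun j _ => by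
          refine (signAvg_exp_le l (F j) (hF j)).trans ?_
          gcongr
          exact hm j
      _ = _ := by simp
  have hlog := Real.log_nonneg hN
  -- For a single function the infimum is at `l = 0`, approached by `l = 2 δ / (n + 1)`. Otherwise,
  -- for `n > 0`, `l = R / n` minimises `log N / l + n l / 2` with `N = card J`.
  rcases hlog.eq_or_lt with h0 | h0
  · rw [← h0] at key ⊢
    simp only [mul_zero, Real.sqrt_zero, add_zero]
    refine le_of_forall_pos_le_add fun δ hδ => ?_
    have h1 := key (2 * δ / (n + 1)) (by positivity)
    have h2 : signAvg G ≤ m + n * (2 * δ / (n + 1)) / 2 := by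
      refine le_of_mul_le_mul_left (h1.trans (le_of_eq ?_))
        (show (0 : ℝ) < 2 * δ / (n + 1) by positivity)
      ring
    refine h2.trans ?_
    have : (n : ℝ) * (2 * δ / (n + 1)) / 2 = δ * (n / (n + 1)) := by field_simp
    rw [this]
    have : (n : ℝ) / (n + 1) ≤ 1 := by rw [div_le_one (by positivity)]; linarith
    nlinarith
  · rcases n.eq_zero_or_pos with rfl | hn
    · obtain ⟨j, hj⟩ := hG default
      have := hm j
      rw [signAvg_zero] at this ⊢
      simpa using hj.trans this
    · have hn' : (0 : ℝ) < n := by exact_mod_cast hn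
      set R := Real.sqrt (2 * n * Real.log (Fintype.card J)) with hR
      have hRpos : 0 < R := Real.sqrt_pos.2 (by positivity)
      have hsq : R ^ 2 = 2 * n * Real.log (Fintype.card J) := Real.sq_sqrt (by positivity)
      have h1 := key (R / n) (by positivity)
      refine le_of_mul_le_mul_left (h1.trans (le_of_eq ?_)) (show 0 < R / n by positivity)
      have : Real.log (Fintype.card J) = R ^ 2 / (2 * n) := by rw [hsq]; field_simp
      rw [this]
      field_simp
      ring

/-! ### The contraction principle -/

section Contraction

variable {ι : Type*}

/-- For a pair `w`, `w'` with `a w ≥ a w'`, the inequality `b w - b w' ≤ a w - a w'` compares with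
the same pair on the right; otherwise `w` and `w'` exchange roles there. -/
lemma iSup_add_iSup_le_of_contraction [Nonempty ι] (A a b : ι → ℝ)
    (hp : BddAbove (Set.range fun w => A w + a w)) (hm : BddAbove (Set.range fun w => A w - a w))
    (hab : ∀ w w', |b w - b w'| ≤ |a w - a w'|) :
    (⨆ w, (A w + b w)) + (⨆ w, (A w - b w)) ≤ (⨆ w, (A w + a w)) + ⨆ w, (A w - a w) := by
  rw [← le_sub_iff_add_le]
  refine ciSup_le fun w => ?_
  rw [le_sub_iff_add_le, ← le_sub_iff_add_le']
  refine ciSup_le fun w' => ?_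
  have h1 := le_ciSup hp w
  have h2 := le_ciSup hm w'
  have h3 := le_ciSup hp w'
  have h4 := le_ciSup hm w
  have h5 := (le_abs_self _).trans (hab w w')
  rcases abs_cases (a w - a w') with h | h <;> linarith [h.1]

lemma bddAbove_signed_sum {n : ℕ} (G : ι → ℝ) (a : Fin n → ι → ℝ) (hG : ∃ C, ∀ w, |G w| ≤ C)
    (ha : ∃ C, ∀ i w, |a i w| ≤ C) (ε : Fin n → ℤˣ) :
    BddAbove (Set.range fun w => G w + ∑ i, sgn (ε i) * a i w) := by
  obtain ⟨C, hC⟩ := hG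
  obtain ⟨C', hC'⟩ := ha
  refine ⟨C + ∑ _i : Fin n, C', ?_⟩
  rintro _ ⟨w, rfl⟩
  refine add_le_add ((le_abs_self _).trans (hC w)) (Finset.sum_le_sum fun i _ => ?_)
  refine (le_abs_self _).trans ?_
  rw [abs_mul, abs_sgn, one_mul]
  exact hC' i w

/-- The contraction principle for Rademacher averages. -/
lemma signAvg_iSup_le_of_contraction [Nonempty ι] : ∀ {n : ℕ} (G : ι → ℝ) (a b : Fin n → ι → ℝ),
    (∃ C, ∀ w, |G w| ≤ C) → (∃ C, ∀ i w, |a i w| ≤ C) → (∃ C, ∀ i w, |b i w| ≤ C) →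
    (∀ i w w', |b i w - b i w'| ≤ |a i w - a i w'|) →
    signAvg (fun ε => ⨆ w, (G w + ∑ i, sgn (ε i) * b i w)) ≤
      signAvg (fun ε => ⨆ w, (G w + ∑ i, sgn (ε i) * a i w))
  | 0, G, a, b, _, _, _, _ => by simp
  | n + 1, G, a, b, hG, ha, hb, hab => by
    obtain ⟨CG, hCG⟩ := hG
    obtain ⟨Ca, hCa⟩ := ha
    obtain ⟨Cb, hCb⟩ := hb
    have hsucc : ∀ c : Fin (n + 1) → ι → ℝ, ∀ (e : ℤˣ) (ε : Fin n → ℤˣ),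
        (⨆ w, (G w + ∑ i, sgn ((Fin.cons e ε : Fin (n + 1) → ℤˣ) i) * c i w)) =
          ⨆ w, ((G w + ∑ i : Fin n, sgn (ε i) * c i.succ w) + sgn e * c 0 w) := by
      intro c e ε
      congr 1
      ext w
      rw [Fin.sum_univ_succ]
      simp only [Fin.cons_zero, Fin.cons_succ]
      ring
    have hbd : ∀ (e : ℤˣ) (ε : Fin n → ℤˣ), BddAbove (Set.range fun w =>
        (G w + ∑ i : Fin n, sgn (ε i) * b i.succ w) + sgn e * a 0 w) := by
      intro e ε
      have := bddAbove_signed_sum (fun w => G w + sgn e * a 0 w) (fun i => b i.succ)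
        ⟨CG + Ca, fun w => (abs_add_le _ _).trans (add_le_add (hCG w) (by
          rw [abs_mul, abs_sgn, one_mul]; exact hCa 0 w))⟩ ⟨Cb, fun i w => hCb _ w⟩ ε
      convert this using 3
      ring
    rw [signAvg_succ, signAvg_succ]
    -- Only coordinate `0` is contracted here. The resulting `± a 0` joins the free term `G`, to
    -- which the induction hypothesis applies.
    have h1 : ∀ ε : Fin n → ℤˣ,
        ((⨆ w, (G w + ∑ i, sgn ((Fin.cons 1 ε : Fin (n + 1) → ℤˣ) i) * b i w)) +
          ⨆ w, (G w + ∑ i, sgn ((Fin.cons (-1) ε : Fin (n + 1) → ℤˣ) i) * b i w)) / 2 ≤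
        ((⨆ w, ((G w + a 0 w) + ∑ i, sgn (ε i) * b i.succ w)) +
          ⨆ w, ((G w - a 0 w) + ∑ i, sgn (ε i) * b i.succ w)) / 2 := by
      intro ε
      rw [hsucc, hsucc]
      have hp := hbd 1 ε
      have hm := hbd (-1) ε
      simp only [sgn_one, sgn_neg_one, one_mul, neg_mul, ← sub_eq_add_neg] at hp hm ⊢
      have := iSup_add_iSup_le_of_contraction _ _ _ hp hm (hab 0)
      simp only [add_right_comm (G _) (a 0 _), add_comm (G _ - a 0 _), ← add_sub_assoc,
        add_comm _ (G _)]
      linarith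
    refine (signAvg_mono h1).trans ?_
    rw [signAvg_div, signAvg_div, signAvg_add, signAvg_add]
    have ih1 := signAvg_iSup_le_of_contraction (fun w => G w + a 0 w) (fun i => a i.succ)
      (fun i => b i.succ) ⟨CG + Ca, fun w => (abs_add_le _ _).trans (add_le_add (hCG w) (hCa 0 w))⟩
      ⟨Ca, fun i w => hCa _ w⟩ ⟨Cb, fun i w => hCb _ w⟩ fun i => hab _
    have ih2 := signAvg_iSup_le_of_contraction (fun w => G w - a 0 w) (fun i => a i.succ)
      (fun i => b i.succ) ⟨CG + Ca, fun w => (abs_sub _ _).trans (add_le_add (hCG w) (hCa 0 w))⟩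
      ⟨Ca, fun i w => hCa _ w⟩ ⟨Cb, fun i w => hCb _ w⟩ fun i => hab _
    have e1 : ∀ ε : Fin n → ℤˣ,
        (⨆ w, (G w + ∑ i, sgn ((Fin.cons 1 ε : Fin (n + 1) → ℤˣ) i) * a i w)) =
          ⨆ w, ((G w + a 0 w) + ∑ i, sgn (ε i) * a i.succ w) := by
      intro ε
      rw [hsucc]
      congr 1; ext w; rw [sgn_one]; ring
    have e2 : ∀ ε : Fin n → ℤˣ,
        (⨆ w, (G w + ∑ i, sgn ((Fin.cons (-1) ε : Fin (n + 1) → ℤˣ) i) * a i w)) =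
          ⨆ w, ((G w - a 0 w) + ∑ i, sgn (ε i) * a i.succ w) := by
      intro ε
      rw [hsucc]
      congr 1; ext w; rw [sgn_neg_one]; ring
    simp only [e1, e2]
    linarith

end Contraction

/-! ### Norms of signed sums -/

section Linear

variable {E : Type*} [NormedAddCommGroup E] [InnerProductSpace ℝ E]

/-- Averaging over one sign is the parallelogram law, which removes the cross terms. -/
lemma signAvg_norm_add_sum_sq : ∀ {n : ℕ} (x : E) (u : Fin n → E),
    signAvg (fun ε => ‖x + ∑ i, sgn (ε i) • u i‖ ^ 2) = ‖x‖ ^ 2 + ∑ i, ‖u i‖ ^ 2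
  | 0, x, u => by simp
  | n + 1, x, u => by
    rw [signAvg_succ, Fin.sum_univ_succ, ← add_assoc]
    have h : ∀ ε : Fin n → ℤˣ,
        (‖x + ∑ i, sgn ((Fin.cons 1 ε : Fin (n + 1) → ℤˣ) i) • u i‖ ^ 2 +
          ‖x + ∑ i, sgn ((Fin.cons (-1) ε : Fin (n + 1) → ℤˣ) i) • u i‖ ^ 2) / 2 =
        ‖x + ∑ i, sgn (ε i) • u i.succ‖ ^ 2 + ‖u 0‖ ^ 2 := by
      intro ε
      simp only [Fin.sum_univ_succ, Fin.cons_zero, Fin.cons_succ, sgn_one, sgn_neg_one, one_smul,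
        neg_smul]
      have := parallelogram_law_with_norm ℝ (x + ∑ i, sgn (ε i) • u i.succ) (u 0)
      rw [show x + (u 0 + ∑ i, sgn (ε i) • u i.succ) = x + ∑ i, sgn (ε i) • u i.succ + u 0 by abel,
        show x + (-u 0 + ∑ i, sgn (ε i) • u i.succ) = x + ∑ i, sgn (ε i) • u i.succ - u 0 by abel]
      linarith
    simp only [h]
    rw [signAvg_add, signAvg_const, signAvg_norm_add_sum_sq]
    ring

lemma signAvg_norm_sum_le {n : ℕ} (u : Fin n → E) :
    signAvg (fun ε => ‖∑ i, sgn (ε i) • u i‖) ≤ Real.sqrt (∑ i, ‖u i‖ ^ 2) := by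
  have h := signAvg_norm_add_sum_sq 0 u
  simp only [zero_add, norm_zero, ne_eq, OfNat.ofNat_ne_zero, not_false_eq_true, zero_pow] at h
  refine Real.le_sqrt_of_sq_le ?_
  rw [← h]
  set m := signAvg fun ε => ‖∑ i, sgn (ε i) • u i‖ with hm
  have h2 := signAvg_mono (n := n) (F := fun ε => 2 * m * ‖∑ i, sgn (ε i) • u i‖ + -m ^ 2)
    (G := fun ε => ‖∑ i, sgn (ε i) • u i‖ ^ 2) fun ε => by
      nlinarith [sq_nonneg (m - ‖∑ i, sgn (ε i) • u i‖)]
  rw [signAvg_add, signAvg_mul_left, signAvg_const, ← hm] at h2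
  linarith

end Linear

/-! ### Symmetrization with a ghost sample -/

section Symmetrization

variable {Z ι : Type*}

/-- The (unnormalised) empirical Rademacher average of the family `ψ` at the sample `z`. -/
noncomputable def rademacher {n : ℕ} (ψ : ι → Z → ℝ) (z : Fin n → Z) : ℝ :=
  signAvg fun ε => ⨆ i, ∑ k, sgn (ε k) * ψ i (z k)

lemma abs_ciSup_le [Nonempty ι] {f : ι → ℝ} {C : ℝ} (h : ∀ i, |f i| ≤ C) : |⨆ i, f i| ≤ C := by
  obtain ⟨i⟩ := ‹Nonempty ι›
  rw [abs_le]
  refine ⟨(abs_le.1 (h i)).1.trans (le_ciSup (f := f) ⟨C, ?_⟩ i), ?_⟩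
  · rintro _ ⟨j, rfl⟩
    exact (abs_le.1 (h j)).2
  · have : Nonempty ι := ⟨i⟩
    exact ciSup_le fun j => (abs_le.1 (h j)).2

lemma abs_signed_sum_le {n : ℕ} (ε : Fin n → ℤˣ) (x : Fin n → ℝ) {C : ℝ} (h : ∀ k, |x k| ≤ C) :
    |∑ k, sgn (ε k) * x k| ≤ n * C := by
  refine (Finset.abs_sum_le_sum_abs _ _).trans ?_
  calc ∑ k, |sgn (ε k) * x k| ≤ ∑ _k : Fin n, C := Finset.sum_le_sum fun k _ => by
        rw [abs_mul, abs_sgn, one_mul]; exact h k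
    _ = n * C := by simp

lemma abs_sum_sub_le {n : ℕ} {ψ : ι → Z → ℝ} (hb : ∀ i z, |ψ i z| ≤ 1) (s s' : Fin n → Z) (i : ι) :
    |∑ k, (ψ i (s' k) - ψ i (s k))| ≤ n * 2 := by
  refine (Finset.abs_sum_le_sum_abs _ _).trans ?_
  calc ∑ k, |ψ i (s' k) - ψ i (s k)| ≤ ∑ _k : Fin n, (2 : ℝ) := Finset.sum_le_sum fun k _ => by
        have h1 := abs_le.1 (hb i (s' k))
        have h2 := abs_le.1 (hb i (s k))
        rw [abs_le]
        constructor <;> linarith [h1.1, h1.2, h2.1, h2.2]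
    _ = n * 2 := by simp

lemma abs_rademacher_le [Nonempty ι] {n : ℕ} {ψ : ι → Z → ℝ} (hb : ∀ i z, |ψ i z| ≤ 1)
    (z : Fin n → Z) : |rademacher ψ z| ≤ n := by
  have h : ∀ ε : Fin n → ℤˣ, |⨆ i, ∑ k, sgn (ε k) * ψ i (z k)| ≤ n := fun ε =>
    abs_ciSup_le fun i => by simpa using abs_signed_sum_le ε _ fun k => hb i (z k)
  rw [abs_le, rademacher]
  constructor
  · simpa using signAvg_mono (F := fun _ => -(n : ℝ)) fun ε => (abs_le.1 (h ε)).1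
  · simpa using signAvg_mono (G := fun _ => (n : ℝ)) fun ε => (abs_le.1 (h ε)).2

variable [MeasurableSpace Z]

lemma measurable_rademacher [Countable ι] {n : ℕ} {ψ : ι → Z → ℝ} (hψ : ∀ i, Measurable (ψ i)) :
    Measurable (rademacher (n := n) ψ) := by
  unfold rademacher signAvg
  refine Measurable.div_const (Finset.measurable_sum _ fun ε _ => Measurable.iSup fun i => ?_) _
  exact Finset.measurable_sum _ fun k _ =>
    ((hψ i).comp (measurable_pi_apply k)).const_mul _

lemma integrable_rademacher [Countable ι] [Nonempty ι] {n : ℕ} {ψ : ι → Z → ℝ}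
    (hψ : ∀ i, Measurable (ψ i)) (hb : ∀ i z, |ψ i z| ≤ 1) (P : Measure (Fin n → Z))
    [IsFiniteMeasure P] : Integrable (rademacher ψ) P :=
  Integrable.of_bound (measurable_rademacher hψ).aestronglyMeasurable n
    (Filter.Eventually.of_forall fun z => abs_rademacher_le hb z)

/-- The largest deviation, over the family `ψ`, between the sums over two samples. -/
noncomputable def deviation {n : ℕ} (ψ : ι → Z → ℝ) (s s' : Fin n → Z) : ℝ :=
  ⨆ i, ∑ k, (ψ i (s' k) - ψ i (s k))

lemma measurable_deviation [Countable ι] {n : ℕ} {ψ : ι → Z → ℝ} (hψ : ∀ i, Measurable (ψ i)) :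
    Measurable fun p : (Fin n → Z) × (Fin n → Z) => deviation ψ p.1 p.2 :=
  Measurable.iSup fun i => Finset.measurable_sum _ fun k _ =>
    ((hψ i).comp ((measurable_pi_apply k).comp measurable_snd)).sub
      ((hψ i).comp ((measurable_pi_apply k).comp measurable_fst))

lemma integrable_deviation [Countable ι] [Nonempty ι] {n : ℕ} {ψ : ι → Z → ℝ}
    (hψ : ∀ i, Measurable (ψ i)) (hb : ∀ i z, |ψ i z| ≤ 1)
    (P : Measure ((Fin n → Z) × (Fin n → Z))) [IsFiniteMeasure P] :
    Integrable (fun p => deviation ψ p.1 p.2) P :=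
  Integrable.of_bound (measurable_deviation hψ).aestronglyMeasurable (n * 2)
    (Filter.Eventually.of_forall fun p => abs_ciSup_le fun i => abs_sum_sub_le hb p.1 p.2 i)

/-- Exchanging the two entries of the `k`-th pair for all `k` with sign `-1`. -/
def swapPairs {n : ℕ} (ε : Fin n → ℤˣ) (q : Fin n → Z × Z) : Fin n → Z × Z :=
  fun k => if ε k = 1 then q k else (q k).swap

lemma measurePreserving_swapPairs {n : ℕ} (μ : Measure Z) [IsProbabilityMeasure μ]
    (ε : Fin n → ℤˣ) :
    MeasurePreserving (swapPairs ε) (Measure.pi fun _ : Fin n => μ.prod μ)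
      (Measure.pi fun _ : Fin n => μ.prod μ) := by
  refine measurePreserving_pi (f := fun k (x : Z × Z) => if ε k = 1 then x else x.swap) _ _
    fun k => ?_
  by_cases h : ε k = 1
  · simp only [h, if_true]
    exact MeasurePreserving.id (μ.prod μ)
  · simp only [h, if_false]
    exact Measure.measurePreserving_swap (μ := μ) (ν := μ)

/-- Symmetrization. -/
lemma integral_deviation_le [Countable ι] [Nonempty ι] {n : ℕ} {ψ : ι → Z → ℝ}
    (hψ : ∀ i, Measurable (ψ i)) (hb : ∀ i z, |ψ i z| ≤ 1) (μ : Measure Z)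
    [IsProbabilityMeasure μ] :
    ∫ s, ∫ s', deviation ψ s s' ∂(Measure.pi fun _ : Fin n => μ) ∂(Measure.pi fun _ : Fin n => μ) ≤
      2 * ∫ s, rademacher ψ s ∂(Measure.pi fun _ : Fin n => μ) := by
  set π := Measure.pi fun _ : Fin n => μ with hπ
  set Q := Measure.pi fun _ : Fin n => μ.prod μ with hQ
  set D : (Fin n → Z × Z) → ℝ := fun q => deviation ψ (fun k => (q k).1) (fun k => (q k).2) with hD
  have he := measurePreserving_arrowProdEquivProdArrow Z Z (Fin n) (fun _ => μ) (fun _ => μ)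
  have hfst : MeasurePreserving (fun (q : Fin n → Z × Z) k => (q k).1) Q π :=
    measurePreserving_pi (f := fun _ (x : Z × Z) => x.1) _ _ fun _ => measurePreserving_fst
  have hsnd : MeasurePreserving (fun (q : Fin n → Z × Z) k => (q k).2) Q π :=
    measurePreserving_pi (f := fun _ (x : Z × Z) => x.2) _ _ fun _ => measurePreserving_snd
  have hDm : Measurable D :=
    (measurable_deviation hψ).comp (hfst.measurable.prodMk hsnd.measurable)
  have hDb : ∀ q, |D q| ≤ n * 2 := fun q => abs_ciSup_le fun i => abs_sum_sub_le hb _ _ i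
  -- Two independent samples become one sample of `n` independent pairs, whose entries can be
  -- exchanged pair by pair without changing the law.
  have h0 : ∫ s, ∫ s', deviation ψ s s' ∂π ∂π = ∫ q, D q ∂Q := by
    rw [← integral_prod _ (integrable_deviation hψ hb (π.prod π))]
    exact (he.integral_comp (MeasurableEquiv.measurableEmbedding _)
      (fun p : (Fin n → Z) × (Fin n → Z) => deviation ψ p.1 p.2)).symm
  have hswap : ∀ ε : Fin n → ℤˣ, ∫ q, D (swapPairs ε q) ∂Q = ∫ q, D q ∂Q := by
    intro ε
    have h := measurePreserving_swapPairs μ ε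
    conv_rhs => rw [hQ, ← h.map_eq]
    rw [integral_map h.measurable.aemeasurable hDm.aestronglyMeasurable]
  have hint : ∀ ε : Fin n → ℤˣ, Integrable (fun q => D (swapPairs ε q)) Q := fun ε =>
    Integrable.of_bound (hDm.comp (measurePreserving_swapPairs μ ε).measurable).aestronglyMeasurable
      (n * 2) (Filter.Eventually.of_forall fun q => hDb _)
  have havg : ∫ q, D q ∂Q = ∫ q, signAvg (fun ε => D (swapPairs ε q)) ∂Q := by
    have : ∫ q, D q ∂Q = signAvg fun ε : Fin n → ℤˣ => ∫ q, D (swapPairs ε q) ∂Q := by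
      simp only [hswap, signAvg_const]
    rw [this]
    simp only [signAvg]
    rw [integral_div, integral_finsetSum _ fun ε _ => hint ε]
  have hpt : ∀ q, signAvg (fun ε => D (swapPairs ε q)) ≤
      rademacher ψ (fun k => (q k).2) + rademacher ψ (fun k => (q k).1) := by
    intro q
    have hbdd : ∀ (ε : Fin n → ℤˣ) (z : Fin n → Z),
        BddAbove (Set.range fun i => ∑ k, sgn (ε k) * ψ i (z k)) := by
      intro ε z
      refine ⟨n * 1, ?_⟩
      rintro _ ⟨i, rfl⟩
      exact (abs_le.1 (abs_signed_sum_le ε _ fun k => hb i (z k))).2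
    -- The first entries carry the opposite signs; `ε ↦ -ε` leaves the average unchanged.
    have hneg : rademacher ψ (fun k => (q k).1) =
        signAvg fun ε : Fin n → ℤˣ => ⨆ i, ∑ k, sgn ((-ε) k) * ψ i (q k).1 :=
      (signAvg_neg _).symm
    rw [hneg, rademacher, ← signAvg_add]
    refine signAvg_mono fun ε => ciSup_le fun i => ?_
    refine le_trans (le_of_eq ?_) (add_le_add (le_ciSup (hbdd ε fun k => (q k).2) i)
      (le_ciSup (hbdd (-ε) fun k => (q k).1) i))
    rw [← Finset.sum_add_distrib]
    refine Finset.sum_congr rfl fun k _ => ?_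
    rcases Int.units_eq_one_or (ε k) with h | h
    · simp [swapPairs, h]; ring
    · simp [swapPairs, h, show (-1 : ℤˣ) ≠ 1 by decide]; ring
  have hr : ∀ f : (Fin n → Z × Z) → Fin n → Z, MeasurePreserving f Q π →
      Integrable (fun q => rademacher ψ (f q)) Q ∧
        ∫ q, rademacher ψ (f q) ∂Q = ∫ s, rademacher ψ s ∂π := by
    intro f hf
    refine ⟨Integrable.of_bound ((measurable_rademacher hψ).comp hf.measurable).aestronglyMeasurable
      n (Filter.Eventually.of_forall fun q => abs_rademacher_le hb _), ?_⟩
    rw [← hf.map_eq, integral_map hf.measurable.aemeasurable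
      (measurable_rademacher hψ).aestronglyMeasurable]
  rw [h0, havg]
  refine (integral_mono ?_ ((hr _ hsnd).1.add (hr _ hfst).1) hpt).trans (le_of_eq ?_)
  · simp only [signAvg]
    exact (integrable_finsetSum _ fun ε _ => hint ε).div_const _
  · rw [integral_add' (hr _ hsnd).1 (hr _ hfst).1, (hr _ hsnd).2, (hr _ hfst).2, two_mul]

end Symmetrization

/-! ### Rademacher averages of shifted ramps -/

section Ramp

variable {Z E κ J : Type*} [NormedAddCommGroup E] [InnerProductSpace ℝ E]

/-- Rademacher average of finitely many shifts of a Lipschitz function of linear functionals. -/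
lemma rademacher_lipschitz_le [Nonempty κ] [Fintype J] [Nonempty J] {n : ℕ} (φ : ℝ → ℝ) (L : ℝ≥0)
    (hφ : LipschitzWith L φ) (hφb : ∀ x, |φ x| ≤ 1) (u : Z → E) (h : J → Z → ℝ) (W : κ → E)
    (hW : ∀ q, ‖W q‖ ≤ 1) (z : Fin n → Z) :
    rademacher (fun (p : κ × J) x => φ (inner ℝ (u x) (W p.1) + h p.2 x)) z ≤
      L * Real.sqrt (∑ k, ‖u (z k)‖ ^ 2) + Real.sqrt (2 * n * Real.log (Fintype.card J)) := by
  set b : J → Fin n → κ → ℝ := fun j k q => φ (inner ℝ (u (z k)) (W q) + h j (z k)) with hb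
  have hb1 : ∀ j k q, |b j k q| ≤ 1 := fun j k q => hφb _
  have hbdd : ∀ j (ε : Fin n → ℤˣ), BddAbove (Set.range fun q => ∑ k, sgn (ε k) * b j k q) := by
    intro j ε
    refine ⟨n * 1, ?_⟩
    rintro _ ⟨q, rfl⟩
    exact (abs_le.1 (abs_signed_sum_le ε _ fun k => hb1 j k q)).2
  -- For each shift, the supremum over all of `κ` is a single function of the signs, so the
  -- logarithm counts only the shifts.
  refine signAvg_le_of_forall_le (fun j ε => ⨆ q, ∑ k, sgn (ε k) * b j k q) _ _ ?_ ?_ ?_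
  · have hle : ∀ j (ε ε' : Fin n → ℤˣ) i, (∀ k, k ≠ i → ε k = ε' k) →
        (⨆ q, ∑ k, sgn (ε k) * b j k q) ≤ (⨆ q, ∑ k, sgn (ε' k) * b j k q) + 2 := by
      intro j ε ε' i hi
      refine ciSup_le fun q => ?_
      have h1 := le_ciSup (hbdd j ε') q
      refine le_trans ?_ (add_le_add_left h1 2)
      rw [← sub_le_iff_le_add', ← Finset.sum_sub_distrib, Finset.sum_eq_single i]
      · have h2 := abs_le.1 (hb1 j i q)
        rcases sgn_eq_or (ε i) with h3 | h3 <;> rcases sgn_eq_or (ε' i) with h4 | h4 <;>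
          rw [h3, h4] <;> linarith [h2.1, h2.2]
      · intro k _ hk
        rw [hi k hk, sub_self]
      · simp
    intro j ε ε' i hi
    rw [abs_sub_le_iff]
    constructor
    · linarith [hle j ε ε' i hi]
    · linarith [hle j ε' ε i fun k hk => (hi k hk).symm]
  · intro j
    have hcb : ∀ (k : Fin n) q, |(L : ℝ) * inner ℝ (u (z k)) (W q)| ≤ L * ∑ k, ‖u (z k)‖ := by
      intro k q
      rw [abs_mul, NNReal.abs_eq]
      refine mul_le_mul_of_nonneg_left ((abs_real_inner_le_norm _ _).trans ?_) L.2
      refine (mul_le_of_le_one_right (norm_nonneg _) (hW q)).trans ?_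
      exact Finset.single_le_sum (f := fun k => ‖u (z k)‖) (fun _ _ => norm_nonneg _)
        (Finset.mem_univ k)
    -- The shift `h j` cancels in differences, so the comparison is with the purely linear class.
    have hc := signAvg_iSup_le_of_contraction (fun _ : κ => 0)
      (fun k q => (L : ℝ) * inner ℝ (u (z k)) (W q)) (b j) ⟨0, by simp⟩ ⟨_, hcb⟩
      ⟨1, fun k q => hb1 j k q⟩ fun k q q' => by
        have h1 := hφ.dist_le_mul (inner ℝ (u (z k)) (W q) + h j (z k))
          (inner ℝ (u (z k)) (W q') + h j (z k))
        rw [Real.dist_eq, Real.dist_eq, add_sub_add_right_eq_sub] at h1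
        rwa [← mul_sub, abs_mul, NNReal.abs_eq]
    simp only [zero_add] at hc
    refine hc.trans ?_
    refine le_trans (signAvg_mono (G := fun ε => L * ‖∑ k, sgn (ε k) • u (z k)‖) fun ε => ?_) ?_
    · refine ciSup_le fun q => ?_
      have : ∑ k, sgn (ε k) * ((L : ℝ) * inner ℝ (u (z k)) (W q)) =
          L * inner ℝ (∑ k, sgn (ε k) • u (z k)) (W q) := by
        rw [sum_inner, Finset.mul_sum]
        refine Finset.sum_congr rfl fun k _ => ?_
        rw [real_inner_smul_left]
        ring
      rw [this]
      refine mul_le_mul_of_nonneg_left ((real_inner_le_norm _ _).trans ?_) L.2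
      exact mul_le_of_le_one_right (norm_nonneg _) (hW q)
    · rw [signAvg_mul_left]
      exact mul_le_mul_of_nonneg_left (signAvg_norm_sum_le _) L.2
  · intro ε
    obtain ⟨j, hj⟩ := Finite.exists_max fun j => ⨆ q, ∑ k, sgn (ε k) * b j k q
    exact ⟨j, ciSup_le fun p => (le_ciSup (hbdd p.2 ε) p.1).trans (hj p.2)⟩

/-- The piecewise linear function equal to `1` below `θ / 3` and to `0` above `2 θ / 3`. -/
noncomputable def ramp (θ x : ℝ) : ℝ := min 1 (max 0 (2 - 3 / θ * x))

lemma ramp_nonneg (θ x : ℝ) : 0 ≤ ramp θ x := le_min zero_le_one (le_max_left _ _)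

lemma ramp_le_one (θ x : ℝ) : ramp θ x ≤ 1 := min_le_left _ _

lemma abs_ramp_le (θ x : ℝ) : |ramp θ x| ≤ 1 := by
  rw [abs_of_nonneg (ramp_nonneg θ x)]
  exact ramp_le_one θ x

lemma ramp_eq_one {θ x : ℝ} (hθ : 0 < θ) (hx : x ≤ θ / 3) : ramp θ x = 1 := by
  have : 3 / θ * x ≤ 1 := by rw [div_mul_eq_mul_div, div_le_one hθ]; linarith
  exact min_eq_left (le_max_of_le_right (by linarith))

lemma ramp_eq_zero {θ x : ℝ} (hθ : 0 < θ) (hx : 2 * θ / 3 ≤ x) : ramp θ x = 0 := by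
  have : 2 ≤ 3 / θ * x := by rw [div_mul_eq_mul_div, le_div_iff₀ hθ]; linarith
  rw [ramp, max_eq_left (by linarith), min_eq_right zero_le_one]

lemma lipschitzWith_ramp {θ : ℝ} (hθ : 0 < θ) : LipschitzWith (Real.toNNReal (3 / θ)) (ramp θ) := by
  have h : LipschitzWith (Real.toNNReal (3 / θ)) fun x => 2 - 3 / θ * x := by
    refine LipschitzWith.of_dist_le_mul fun x y => ?_
    rw [Real.dist_eq, Real.dist_eq, Real.coe_toNNReal _ (by positivity), sub_sub_sub_cancel_left,
      ← mul_sub, abs_mul, abs_of_nonneg (show 0 ≤ 3 / θ by positivity), abs_sub_comm]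
  exact (h.const_max 0).const_min 1

/-- Rounding towards zero to a multiple of `δ`. -/
lemma exists_int_abs_sub_mul_le {δ B t : ℝ} (hδ : 0 < δ) (ht : |t| ≤ B) :
    ∃ j : Set.Icc (-(⌊B / δ⌋₊ : ℤ)) (⌊B / δ⌋₊ : ℤ), |t - (j : ℤ) * δ| ≤ δ := by
  -- Rounding down a nonnegative number keeps the index below `⌊B / δ⌋₊`; nearest-point rounding
  -- could exceed it. The error is then bounded by `δ`.
  have key : ∀ s : ℝ, 0 ≤ s → s ≤ B → ∃ j : ℕ, j ≤ ⌊B / δ⌋₊ ∧ |s - j * δ| ≤ δ := by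
    intro s hs hsB
    refine ⟨⌊s / δ⌋₊, Nat.floor_le_floor (by gcongr), ?_⟩
    have h1 := Nat.floor_le (show 0 ≤ s / δ by positivity)
    have h2 := Nat.lt_floor_add_one (s / δ)
    rw [le_div_iff₀ hδ] at h1
    rw [div_lt_iff₀ hδ] at h2
    rw [abs_le]
    constructor <;> linarith
  rcases le_total 0 t with h | h
  · rw [abs_of_nonneg h] at ht
    obtain ⟨j, hj, hj'⟩ := key t h ht
    exact ⟨⟨j, by constructor <;> omega⟩, by simpa using hj'⟩
  · rw [abs_of_nonpos h] at ht
    obtain ⟨j, hj, hj'⟩ := key (-t) (by linarith) ht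
    refine ⟨⟨-j, by constructor <;> omega⟩, ?_⟩
    rw [← abs_neg]
    simpa [sub_eq_add_neg, add_comm] using hj'

end Ramp

/-! ### Measurability and range of the risks -/

lemma measurable_sgn : Measurable sgn :=
  (Measurable.of_discrete (f := fun m : ℤ => (m : ℝ))).comp (comap_measurable _)

lemma marginLoss_nonneg {d : ℕ} (θ : ℝ) (z : Sample d) (w : Feature d) : 0 ≤ marginLoss θ z w := by
  unfold marginLoss; split_ifs <;> simp

lemma marginLoss_le_one {d : ℕ} (θ : ℝ) (z : Sample d) (w : Feature d) : marginLoss θ z w ≤ 1 := by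
  unfold marginLoss; split_ifs <;> simp

lemma measurable_marginLoss {d : ℕ} (θ : ℝ) :
    Measurable fun p : Sample d × Feature d => marginLoss θ p.1 p.2 := by
  refine Measurable.ite (measurableSet_lt ?_ measurable_const) measurable_const measurable_const
  exact (measurable_sgn.comp (measurable_snd.comp measurable_fst)).mul
    (Measurable.inner (measurable_fst.comp measurable_fst) measurable_snd)

lemma measurable_popRisk {d : ℕ} (μ : Measure (Sample d)) [SFinite μ] : Measurable (popRisk μ) := by
  have h := (measurable_marginLoss (d := d) 0).comp measurable_swap
  exact (StronglyMeasurable.integral_prod_right (ν := μ)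
    (f := fun w z => marginLoss 0 z w) h.stronglyMeasurable).measurable

lemma measurable_empRisk {d n : ℕ} (θ : ℝ) :
    Measurable fun p : ClientOutcome d n => empRisk θ p.1 p.2 :=
  (Finset.measurable_sum _ fun i _ => (measurable_marginLoss θ).comp
    (((measurable_pi_apply i).comp measurable_fst).prodMk measurable_snd)).const_mul _

lemma popRisk_mem {d : ℕ} (μ : Measure (Sample d)) [IsProbabilityMeasure μ] (w : Feature d) :
    0 ≤ popRisk μ w ∧ popRisk μ w ≤ 1 := by
  refine ⟨integral_nonneg fun z => marginLoss_nonneg _ _ _, ?_⟩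
  refine (integral_mono_of_nonneg (Filter.Eventually.of_forall fun z => marginLoss_nonneg _ _ _)
    (integrable_const (1 : ℝ)) (Filter.Eventually.of_forall fun z => marginLoss_le_one _ _ _)).trans ?_
  simp

lemma empRisk_mem {d n : ℕ} (θ : ℝ) (s : Fin n → Sample d) (w : Feature d) :
    0 ≤ empRisk θ s w ∧ empRisk θ s w ≤ 1 := by
  refine ⟨mul_nonneg (by positivity) (Finset.sum_nonneg fun i _ => marginLoss_nonneg _ _ _), ?_⟩
  have h : ∑ i, marginLoss θ (s i) w ≤ n := by
    simpa using Finset.sum_le_sum fun i (_ : i ∈ Finset.univ) => marginLoss_le_one θ (s i) w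
  rw [empRisk, one_div]
  rcases n.eq_zero_or_pos with rfl | hn
  · simp
  · exact inv_mul_le_one_of_le₀ h (by positivity)

/-- The population risk is the mean of the empirical risk of an independent sample. -/
lemma popRisk_eq_integral {d n : ℕ} (μ : Measure (Sample d)) [IsProbabilityMeasure μ]
    (w : Feature d) :
    n * popRisk μ w = ∫ s, ∑ k, marginLoss 0 (s k) w ∂(Measure.pi fun _ : Fin n => μ) := by
  have hm : Measurable fun z : Sample d => marginLoss 0 z w :=
    (measurable_marginLoss 0).comp (measurable_id.prodMk measurable_const)
  have he := fun k : Fin n => measurePreserving_eval (fun _ : Fin n => μ) k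
  rw [integral_finsetSum]
  · have : ∀ k : Fin n, ∫ s : Fin n → Sample d, marginLoss 0 (s k) w
        ∂(Measure.pi fun _ : Fin n => μ) = popRisk μ w := fun k => by
      conv_rhs => rw [popRisk, ← (he k).map_eq]
      rw [integral_map (he k).measurable.aemeasurable hm.aestronglyMeasurable]
    simp [this]
  · intro k _
    refine Integrable.of_bound (hm.comp (measurable_pi_apply k)).aestronglyMeasurable 1
      (Filter.Eventually.of_forall fun s => ?_)
    rw [Real.norm_eq_abs, abs_of_nonneg (marginLoss_nonneg _ _ _)]
    exact marginLoss_le_one _ _ _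

/-! ### Square roots of sums over a sample -/

lemma integral_add_const_of_prob {Z : Type*} [MeasurableSpace Z] {μ : Measure Z}
    [IsProbabilityMeasure μ] {f : Z → ℝ} (hf : Integrable f μ) (c : ℝ) :
    ∫ z, (f z + c) ∂μ = ∫ z, f z ∂μ + c := by
  rw [integral_add hf (integrable_const c)]
  simp

lemma integrable_sqrt_sum {Z : Type*} [MeasurableSpace Z] {n : ℕ} (μ : Measure Z)
    [IsProbabilityMeasure μ] (f : Z → ℝ) (hf : ∀ z, 0 ≤ f z) (hi : Integrable f μ) :
    Integrable (fun s : Fin n → Z => Real.sqrt (∑ k, f (s k))) (Measure.pi fun _ : Fin n => μ) := by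
  have hsum : Integrable (fun s : Fin n → Z => ∑ k, f (s k)) (Measure.pi fun _ : Fin n => μ) :=
    integrable_finsetSum _ fun k _ => ((measurePreserving_eval (fun _ : Fin n => μ) k).integrable_comp
      hi.aestronglyMeasurable).2 hi
  refine (hsum.add (integrable_const 1)).mono'
    (Real.continuous_sqrt.comp_aestronglyMeasurable hsum.aestronglyMeasurable)
    (Filter.Eventually.of_forall fun s => ?_)
  have h0 := Finset.sum_nonneg fun k (_ : k ∈ Finset.univ) => hf (s k)
  rw [Real.norm_eq_abs, abs_of_nonneg (Real.sqrt_nonneg _), Real.sqrt_le_left (by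
    simp only [Pi.add_apply]; positivity)]
  simp only [Pi.add_apply]
  nlinarith

/-- Linearises the root: integrating with `c = √(n V)` gives Jensen's inequality in
`integral_sqrt_sum_le`. -/
lemma sqrt_le_div_add {x c : ℝ} (hx : 0 ≤ x) (hc : 0 < c) :
    Real.sqrt x ≤ x / (2 * c) + c / 2 := by
  have h := Real.sq_sqrt hx
  have h2 : x / (2 * c) + c / 2 - Real.sqrt x = (Real.sqrt x - c) ^ 2 / (2 * c) := by
    rw [sub_sq, h]
    field_simp
    ring
  have h3 : 0 ≤ (Real.sqrt x - c) ^ 2 / (2 * c) := by positivity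
  linarith

lemma integral_sqrt_sum_le {Z : Type*} [MeasurableSpace Z] {n : ℕ} (hn : 0 < n) (μ : Measure Z)
    [IsProbabilityMeasure μ] (f : Z → ℝ) (hf : ∀ z, 0 ≤ f z) (hi : Integrable f μ) {V : ℝ}
    (hV : 0 < V) (hfV : ∫ z, f z ∂μ ≤ V) :
    ∫ s, Real.sqrt (∑ k, f (s k)) ∂(Measure.pi fun _ : Fin n => μ) ≤ Real.sqrt (n * V) := by
  have he := fun k : Fin n => measurePreserving_eval (fun _ : Fin n => μ) k
  have hik : ∀ k : Fin n, Integrable (fun s : Fin n → Z => f (s k))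
      (Measure.pi fun _ : Fin n => μ) := fun k =>
    ((he k).integrable_comp hi.aestronglyMeasurable).2 hi
  have hint : ∀ k : Fin n, ∫ s : Fin n → Z, f (s k) ∂(Measure.pi fun _ : Fin n => μ) =
      ∫ z, f z ∂μ := fun k => by
    conv_rhs => rw [← (he k).map_eq]
    exact (integral_map (he k).measurable.aemeasurable
      ((he k).map_eq.symm ▸ hi.aestronglyMeasurable)).symm
  have hn' : (0 : ℝ) < n := by exact_mod_cast hn
  set c := Real.sqrt (n * V) with hc
  have hcpos : 0 < c := Real.sqrt_pos.2 (by positivity)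
  have hc2 : c ^ 2 = n * V := Real.sq_sqrt (by positivity)
  have hsum : Integrable (fun s : Fin n → Z => ∑ k, f (s k)) (Measure.pi fun _ : Fin n => μ) :=
    integrable_finsetSum _ fun k _ => hik k
  refine (integral_mono_of_nonneg (Filter.Eventually.of_forall fun s => Real.sqrt_nonneg _)
    (g := fun s => (∑ k, f (s k)) / (2 * c) + c / 2)
    ((hsum.div_const _).add (integrable_const _)) (Filter.Eventually.of_forall fun s => ?_)).trans ?_
  · exact sqrt_le_div_add (Finset.sum_nonneg fun k _ => hf (s k)) hcpos
  · rw [integral_add (hsum.div_const _) (integrable_const _), integral_div,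
      integral_finsetSum _ fun k _ => hik k]
    simp only [hint, Finset.sum_const, Finset.card_univ, Fintype.card_fin, nsmul_eq_mul,
      integral_const, probReal_univ, one_smul]
    have : (n * ∫ z, f z ∂μ) / (2 * c) ≤ (n * V) / (2 * c) := by gcongr
    rw [← hc2] at this
    have h2 : c ^ 2 / (2 * c) = c / 2 := by field_simp
    linarith

/-! ### Centred scores and the uniform bound for one client -/

/-- The features of a sample relative to the centre `b`, as they enter the aggregated score. -/
noncomputable def centred {d : ℕ} (κ : ℝ) (b : Feature d) (z : Sample d) : Feature d :=
  (sgn z.2 * κ) • (z.1 - b)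

lemma norm_centred_sq {d : ℕ} (κ : ℝ) (b : Feature d) (z : Sample d) :
    ‖centred κ b z‖ ^ 2 = κ ^ 2 * ‖z.1 - b‖ ^ 2 := by
  rw [centred, norm_smul, mul_pow, Real.norm_eq_abs, abs_mul, abs_sgn, one_mul, sq_abs]

/-- The contribution to the aggregated score of the remaining clients `v` and of the centre, if the
latter is replaced by `t`. -/
noncomputable def offset {d : ℕ} (κ : ℝ) (v : Feature d) (t : ℝ) (z : Sample d) : ℝ :=
  sgn z.2 * (t + κ * inner ℝ z.1 v)

/-- The last summand is the error made by replacing `κ ⟪b, w⟫` with `t`. -/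
lemma score_eq {d : ℕ} (κ : ℝ) (b v w : Feature d) (t : ℝ) (z : Sample d) :
    sgn z.2 * inner ℝ z.1 (κ • (w + v)) =
      inner ℝ (centred κ b z) w + offset κ v t z + sgn z.2 * (κ * inner ℝ b w - t) := by
  rw [centred, offset, real_inner_smul_left, inner_sub_left, real_inner_smul_right, inner_add_right]
  ring

/-- A negative score leaves the rounded score below `θ / 3`, where the ramp is `1`. -/
lemma marginLoss_zero_le_ramp {d : ℕ} {θ : ℝ} (hθ : 0 < θ) (κ : ℝ) (b v w : Feature d) {t : ℝ}
    (ht : |κ * inner ℝ b w - t| ≤ θ / 3) (z : Sample d) :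
    marginLoss 0 z (κ • (w + v)) ≤ ramp θ (inner ℝ (centred κ b z) w + offset κ v t z) := by
  unfold marginLoss
  split_ifs with h
  · rw [ramp_eq_one hθ]
    change sgn z.2 * _ < 0 at h
    rw [score_eq κ b v w t] at h
    have h1 := abs_le.1 ht
    rcases sgn_eq_or z.2 with h2 | h2 <;> rw [h2] at h <;> linarith [h1.1, h1.2]
  · exact ramp_nonneg _ _

/-- A score of at least `θ` leaves the rounded score at least `2 θ / 3`, where the ramp vanishes. -/
lemma ramp_le_marginLoss {d : ℕ} {θ : ℝ} (hθ : 0 < θ) (κ : ℝ) (b v w : Feature d) {t : ℝ}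
    (ht : |κ * inner ℝ b w - t| ≤ θ / 3) (z : Sample d) :
    ramp θ (inner ℝ (centred κ b z) w + offset κ v t z) ≤ marginLoss θ z (κ • (w + v)) := by
  unfold marginLoss
  split_ifs with h
  · exact ramp_le_one _ _
  · rw [ramp_eq_zero hθ]
    change ¬ sgn z.2 * _ < θ at h
    rw [not_lt, score_eq κ b v w t] at h
    have h1 := abs_le.1 ht
    rcases sgn_eq_or z.2 with h2 | h2 <;> rw [h2] at h <;> linarith [h1.1, h1.2]

/-- Uniform deviation bound for the classifiers of one client, the other clients being fixed. -/
lemma exists_uniform_bound {d n : ℕ} (hn : 0 < n) (μ : Measure (Sample d)) [IsProbabilityMeasure μ]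
    (b v : Feature d) {κ θ V : ℝ} (hκ : 0 < κ) (hθ : 0 < θ) (hV : 0 < V)
    (hi : Integrable (fun z : Sample d => ‖z.1 - b‖ ^ 2) μ) (hbV : ∫ z, ‖z.1 - b‖ ^ 2 ∂μ ≤ V) :
    ∃ H : (Fin n → Sample d) → ℝ, Integrable H (Measure.pi fun _ : Fin n => μ) ∧
      (∀ s w, ‖w‖ ≤ 1 → popRisk μ (κ • (w + v)) - empRisk θ s (κ • (w + v)) ≤ H s) ∧
      ∫ s, H s ∂(Measure.pi fun _ : Fin n => μ) ≤
        2 / n * (3 / θ * Real.sqrt (n * (κ ^ 2 * V)) +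
          Real.sqrt (2 * n * Real.log (2 * (⌊κ * ‖b‖ / (θ / 3)⌋₊ : ℝ) + 1))) := by
  have hn' : (0 : ℝ) < n := by exact_mod_cast hn
  set π := Measure.pi fun _ : Fin n => μ with hπ
  set m : ℕ := ⌊κ * ‖b‖ / (θ / 3)⌋₊ with hm
  let J := Set.Icc (-(m : ℤ)) (m : ℤ)
  have hJcard : (Fintype.card J : ℝ) = 2 * m + 1 := by
    have : Fintype.card J = 2 * m + 1 := by
      rw [Fintype.card_of_finset' (Finset.Icc (-(m : ℤ)) m) (by simp [J]), Int.card_Icc]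
      omega
    rw [this]; push_cast; ring
  have : Nonempty J := ⟨⟨0, by constructor <;> simp⟩⟩
  have : Nonempty (Metric.closedBall (0 : Feature d) 1) := ⟨⟨0, by simp⟩⟩
  -- A dense sequence makes the family countable, hence its supremum measurable; continuity of the
  -- ramp recovers the whole ball in `hsup`.
  let W : ℕ → Metric.closedBall (0 : Feature d) 1 := TopologicalSpace.denseSeq _
  let ψ' : Feature d → J → Sample d → ℝ := fun w j z =>
    ramp θ (inner ℝ (centred κ b z) w + offset κ v ((j : ℤ) * (θ / 3)) z)
  let ψ : ℕ × J → Sample d → ℝ := fun p => ψ' (W p.1) p.2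
  have hrc : Continuous (ramp θ) := (lipschitzWith_ramp hθ).continuous
  have hψm : ∀ p, Measurable (ψ p) := fun p => by
    refine hrc.measurable.comp (Measurable.add (Measurable.inner ?_ measurable_const) ?_)
    · exact ((measurable_sgn.comp measurable_snd).mul_const _).smul (measurable_fst.sub_const _)
    · exact (measurable_sgn.comp measurable_snd).mul
        ((Measurable.inner measurable_fst measurable_const).const_mul _ |>.const_add _)
  have hψb : ∀ p z, |ψ p z| ≤ 1 := fun p z => abs_ramp_le _ _
  have hdev := integrable_deviation (n := n) hψm hψb (π.prod π)
  have hsup : ∀ (s s' : Fin n → Sample d) (w : Feature d), ‖w‖ ≤ 1 → ∀ j : J,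
      ∑ k, (ψ' w j (s' k) - ψ' w j (s k)) ≤ deviation ψ s s' := by
    intro s s' w hw j
    have hcont : ∀ z, Continuous fun w : Metric.closedBall (0 : Feature d) 1 =>
        ψ' (w : Feature d) j z := fun z =>
      hrc.comp ((continuous_const.inner continuous_subtype_val).add continuous_const)
    refine isClosed_property (p := fun w : Metric.closedBall (0 : Feature d) 1 =>
      ∑ k, (ψ' (w : Feature d) j (s' k) - ψ' (w : Feature d) j (s k)) ≤ deviation ψ s s')
      (TopologicalSpace.denseRange_denseSeq _) ?_ (fun q => ?_) ⟨w, by simpa using hw⟩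
    · exact isClosed_le (continuous_finsetSum _ fun k _ => (hcont _).sub (hcont _))
        continuous_const
    · refine le_ciSup (f := fun p : ℕ × J => ∑ k, (ψ p (s' k) - ψ p (s k))) ?_ (q, j)
      refine ⟨n * 2, ?_⟩
      rintro _ ⟨p, rfl⟩
      exact (abs_le.1 (abs_sum_sub_le hψb s s' p)).2
  have hdev_s : ∀ s : Fin n → Sample d, Integrable (fun s' => deviation ψ s s') π := fun s =>
    Integrable.of_bound ((measurable_deviation hψm).comp
      (measurable_const.prodMk measurable_id)).aestronglyMeasurable (n * 2)
      (Filter.Eventually.of_forall fun s' => abs_ciSup_le fun p => abs_sum_sub_le hψb s s' p)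
  -- `H s` is the mean largest deviation from a ghost sample `s'`, whose average loss has the
  -- population risk as its mean.
  refine ⟨fun s => 1 / n * ∫ s', deviation ψ s s' ∂π, (hdev.integral_prod_left).const_mul _, ?_, ?_⟩
  · intro s w hw
    obtain ⟨j, hj⟩ := exists_int_abs_sub_mul_le (δ := θ / 3) (B := κ * ‖b‖) (t := κ * inner ℝ b w)
      (by positivity) (by
        rw [abs_mul, abs_of_pos hκ]
        refine mul_le_mul_of_nonneg_left ((abs_real_inner_le_norm _ _).trans ?_) hκ.le
        exact mul_le_of_le_one_right (norm_nonneg _) hw)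
    have h1 : n * popRisk μ (κ • (w + v)) - ∑ k, marginLoss θ (s k) (κ • (w + v)) ≤
        ∫ s', deviation ψ s s' ∂π := by
      rw [popRisk_eq_integral, sub_le_iff_le_add,
        ← integral_add_const_of_prob (hdev_s s)]
      refine integral_mono_of_nonneg (Filter.Eventually.of_forall fun s' =>
        Finset.sum_nonneg fun k _ => marginLoss_nonneg _ _ _)
        ((hdev_s s).add (integrable_const _)) (Filter.Eventually.of_forall fun s' => ?_)
      have h2 := hsup s s' w hw j
      rw [Finset.sum_sub_distrib] at h2
      have h3 := Finset.sum_le_sum fun k (_ : k ∈ Finset.univ) =>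
        marginLoss_zero_le_ramp hθ κ b v w hj (s' k)
      have h4 := Finset.sum_le_sum fun k (_ : k ∈ Finset.univ) =>
        ramp_le_marginLoss hθ κ b v w hj (s k)
      dsimp only
      linarith
    rw [empRisk]
    calc _ = 1 / n * (n * popRisk μ (κ • (w + v)) - ∑ k, marginLoss θ (s k) (κ • (w + v))) := by
          field_simp
      _ ≤ _ := mul_le_mul_of_nonneg_left h1 (by positivity)
  · rw [integral_const_mul]
    have h1 := integral_deviation_le (n := n) hψm hψb μ
    have h2 : ∀ s : Fin n → Sample d, rademacher ψ s ≤
        3 / θ * Real.sqrt (∑ k, ‖centred κ b (s k)‖ ^ 2) +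
          Real.sqrt (2 * n * Real.log (2 * m + 1)) := by
      intro s
      have := rademacher_lipschitz_le (ramp θ) _ (lipschitzWith_ramp hθ) (abs_ramp_le θ)
        (centred κ b) (fun (j : J) => offset κ v ((j : ℤ) * (θ / 3))) (fun q => (W q : Feature d))
        (fun q => mem_closedBall_zero_iff.1 (W q).2) s
      rwa [Real.coe_toNNReal _ (by positivity), hJcard] at this
    have hci : Integrable (fun z => ‖centred κ b z‖ ^ 2) μ := by
      simp only [norm_centred_sq]; exact hi.const_mul _
    have h3 := integral_sqrt_sum_le hn μ (fun z => ‖centred κ b z‖ ^ 2) (fun z => by positivity) hci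
      (V := κ ^ 2 * V) (by positivity) (by
        simp only [norm_centred_sq]; rw [integral_const_mul]; gcongr)
    have hsq : Integrable (fun s : Fin n → Sample d => Real.sqrt (∑ k, ‖centred κ b (s k)‖ ^ 2)) π :=
      integrable_sqrt_sum μ _ (fun z => by positivity) hci
    have h4 : ∫ s, rademacher ψ s ∂π ≤ 3 / θ * Real.sqrt (n * (κ ^ 2 * V)) +
        Real.sqrt (2 * n * Real.log (2 * m + 1)) := by
      refine (integral_mono (integrable_rademacher hψm hψb π)
        ((hsq.const_mul _).add (integrable_const _)) h2).trans ?_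
      rw [integral_add' (hsq.const_mul _) (integrable_const _), integral_const_mul]
      simp only [integral_const, probReal_univ, one_smul]
      gcongr
    calc _ ≤ 1 / (n : ℝ) * (2 * (3 / θ * Real.sqrt (n * (κ ^ 2 * V)) +
        Real.sqrt (2 * n * Real.log (2 * m + 1)))) := by gcongr; linarith
      _ = _ := by ring

/-! ### Resampling one coordinate of a product law -/

section Resampling

variable {ι E : Type*} [Fintype ι] [DecidableEq ι] [MeasurableSpace E]

/-- Resampling one coordinate does not change a product law. -/
lemma map_update_pi_prod (P : ι → Measure E) [∀ i, IsProbabilityMeasure (P i)] (k : ι) :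
    ((Measure.pi P).prod (P k)).map (fun p => Function.update p.1 k p.2) = Measure.pi P := by
  refine (Measure.pi_eq fun s hs => ?_).symm
  rw [Measure.map_apply measurable_update' (MeasurableSet.univ_pi hs)]
  have h : (fun p : (ι → E) × E => Function.update p.1 k p.2) ⁻¹' Set.univ.pi s =
      (Set.univ.pi (Function.update s k Set.univ)) ×ˢ s k := by
    ext p
    simp only [Set.mem_preimage, Set.mem_pi, Set.mem_univ, forall_const, Set.mem_prod]
    constructor
    · intro hp
      refine ⟨fun i => ?_, by simpa using hp k⟩
      rcases eq_or_ne i k with rfl | hi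
      · simp
      · simpa [hi] using hp i
    · rintro ⟨h1, h2⟩ i
      rcases eq_or_ne i k with rfl | hi
      · simpa using h2
      · simpa [hi] using h1 i
  rw [h, Measure.prod_prod, Measure.pi_pi, ← Finset.mul_prod_erase _ _ (Finset.mem_univ k),
    ← Finset.mul_prod_erase _ (fun i => P i (s i)) (Finset.mem_univ k), Function.update_self,
    measure_univ, one_mul, mul_comm]
  congr 1
  refine Finset.prod_congr rfl fun i hi => ?_
  rw [Function.update_of_ne (Finset.ne_of_mem_erase hi)]

/-- Conditions on all coordinates but `k`: redraw coordinate `k`, then apply Fubini. -/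
lemma integral_pi_le_of_update (P : ι → Measure E) [∀ i, IsProbabilityMeasure (P i)] (k : ι)
    {f : (ι → E) → ℝ} (hf : Measurable f) {C B : ℝ} (hC : ∀ ω, |f ω| ≤ C)
    (hB : ∀ ω, ∫ x, f (Function.update ω k x) ∂P k ≤ B) : ∫ ω, f ω ∂Measure.pi P ≤ B := by
  have hm : Measurable fun p : (ι → E) × E => f (Function.update p.1 k p.2) :=
    hf.comp measurable_update'
  have hi : Integrable (fun p : (ι → E) × E => f (Function.update p.1 k p.2))
      ((Measure.pi P).prod (P k)) :=
    Integrable.of_bound hm.aestronglyMeasurable C (Filter.Eventually.of_forall fun p => hC _)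
  rw [← map_update_pi_prod P k, integral_map measurable_update'.aemeasurable
    hf.aestronglyMeasurable, integral_prod _ hi]
  refine (integral_mono hi.integral_prod_left (integrable_const B) hB).trans ?_
  simp

end Resampling

/-! ### Reduction to one client -/

section Clients

variable {d n K : ℕ}

/-- The contribution of one client to the generalization error. -/
noncomputable def clientError (θ : ℝ) (μ : Measure (Sample d)) (k : Fin K)
    (ω : Fin K → ClientOutcome d n) : ℝ :=
  popRisk μ (aggregate ω) - empRisk θ (ω k).1 (aggregate ω)

lemma measurable_aggregate :
    Measurable (aggregate : (Fin K → ClientOutcome d n) → Feature d) :=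
  (Finset.measurable_sum _ fun k _ => measurable_snd.comp (measurable_pi_apply k)).const_smul
    (1 / (K : ℝ))

lemma measurable_clientError (θ : ℝ) (μ : Measure (Sample d)) [SFinite μ] (k : Fin K) :
    Measurable (clientError (n := n) θ μ k) :=
  ((measurable_popRisk μ).comp measurable_aggregate).sub ((measurable_empRisk θ).comp
    ((measurable_fst.comp (measurable_pi_apply k)).prodMk measurable_aggregate))

lemma abs_clientError_le (θ : ℝ) (μ : Measure (Sample d)) [IsProbabilityMeasure μ] (k : Fin K)
    (ω : Fin K → ClientOutcome d n) : |clientError θ μ k ω| ≤ 1 := by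
  have h1 := popRisk_mem μ (aggregate ω)
  have h2 := empRisk_mem θ (ω k).1 (aggregate ω)
  rw [clientError, abs_le]
  constructor <;> linarith [h1.1, h1.2, h2.1, h2.2]

instance (μ : Fin K → Measure (Sample d)) [∀ k, IsProbabilityMeasure (μ k)]
    (A : Fin K → Kernel (Fin n → Sample d) (Feature d)) [∀ k, IsMarkovKernel (A k)] :
    IsProbabilityMeasure (jointLaw μ A) := by
  unfold jointLaw
  infer_instance

lemma integrable_clientError (θ : ℝ) (μ : Measure (Sample d)) [IsProbabilityMeasure μ] (k : Fin K)
    (P : Measure (Fin K → ClientOutcome d n)) [IsFiniteMeasure P] :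
    Integrable (clientError θ μ k) P :=
  Integrable.of_bound (measurable_clientError θ μ k).aestronglyMeasurable 1
    (Filter.Eventually.of_forall fun ω => abs_clientError_le θ μ k ω)

lemma aggregate_update (ω : Fin K → ClientOutcome d n) (k : Fin K) (x : ClientOutcome d n) :
    aggregate (Function.update ω k x) =
      (1 / (K : ℝ)) • (x.2 + ∑ i ∈ Finset.univ.erase k, (ω i).2) := by
  rw [aggregate, ← Finset.add_sum_erase _ _ (Finset.mem_univ k), Function.update_self]
  congr 2
  refine Finset.sum_congr rfl fun i hi => ?_
  rw [Function.update_of_ne (Finset.ne_of_mem_erase hi)]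

/-- A bound for one client that is uniform over its classifiers, whatever the other clients do,
bounds the expected contribution of this client. -/
lemma integral_clientError_le (θ : ℝ) (μ : Fin K → Measure (Sample d))
    [∀ k, IsProbabilityMeasure (μ k)] (A : Fin K → Kernel (Fin n → Sample d) (Feature d))
    [∀ k, IsMarkovKernel (A k)] (hA : ∀ k s, ∀ᵐ w ∂(A k s), ‖w‖ ≤ 1) (k : Fin K) {B : ℝ}
    (hB : ∀ v : Feature d, ∃ H : (Fin n → Sample d) → ℝ,
      Integrable H (Measure.pi fun _ : Fin n => μ k) ∧
      (∀ s w, ‖w‖ ≤ 1 → popRisk (μ k) ((1 / (K : ℝ)) • (w + v)) -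
        empRisk θ s ((1 / (K : ℝ)) • (w + v)) ≤ H s) ∧
      ∫ s, H s ∂(Measure.pi fun _ : Fin n => μ k) ≤ B) :
    ∫ ω, clientError θ (μ k) k ω ∂(jointLaw μ A) ≤ B := by
  refine integral_pi_le_of_update _ k (measurable_clientError θ (μ k) k)
    (abs_clientError_le θ (μ k) k) fun ω => ?_
  -- Here `v` is the sum of the frozen classifiers. As `H` bounds every `w` in the ball, the kernel
  -- `A k` matters only through `‖w‖ ≤ 1`.
  obtain ⟨H, hHi, hH, hHB⟩ := hB (∑ i ∈ Finset.univ.erase k, (ω i).2)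
  set π := Measure.pi fun _ : Fin n => μ k
  have hfst : MeasurePreserving Prod.fst (π ⊗ₘ A k) π :=
    ⟨measurable_fst, Measure.fst_compProd π (A k)⟩
  have hae : ∀ᵐ x ∂(π ⊗ₘ A k), ‖x.2‖ ≤ 1 :=
    Measure.ae_compProd_of_ae_ae (measurableSet_le measurable_snd.norm measurable_const)
      (Filter.Eventually.of_forall fun s => hA k s)
  have hint : Integrable (fun x => clientError θ (μ k) k (Function.update ω k x)) (π ⊗ₘ A k) :=
    Integrable.of_bound ((measurable_clientError θ (μ k) k).comp
      (measurable_update ω)).aestronglyMeasurable 1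
      (Filter.Eventually.of_forall fun x => abs_clientError_le θ (μ k) k _)
  have hle : ∫ x, clientError θ (μ k) k (Function.update ω k x) ∂(π ⊗ₘ A k) ≤
      ∫ x, H x.1 ∂(π ⊗ₘ A k) := by
    refine integral_mono_ae hint ((hfst.integrable_comp hHi.aestronglyMeasurable).2 hHi) ?_
    filter_upwards [hae] with x hx
    rw [clientError, aggregate_update, Function.update_self]
    exact hH x.1 x.2 hx
  refine hle.trans (le_of_eq_of_le ?_ hHB)
  conv_rhs => rw [← hfst.map_eq]
  exact (integral_map hfst.measurable.aemeasurable
    (hfst.map_eq.symm ▸ hHi.aestronglyMeasurable)).symm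

end Clients

/-! ### Second moments of the client laws -/

section Moments

variable {d K M : ℕ}

lemma integrable_sq_foldedGaussian (v : ℝ≥0) :
    Integrable (fun r : ℝ => r ^ 2) (foldedGaussian v) ∧ ∫ r, r ^ 2 ∂(foldedGaussian v) = v := by
  have hm : Measurable fun u : ℝ => |u| := measurable_norm
  have hs : AEStronglyMeasurable (fun r : ℝ => r ^ 2) (foldedGaussian v) := by fun_prop
  constructor
  · rw [foldedGaussian, integrable_map_measure hs hm.aemeasurable]
    have := (memLp_id_gaussianReal (μ := 0) (v := v) 2).integrable_sq
    simpa [Function.comp_def] using this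
  · rw [foldedGaussian, integral_map hm.aemeasurable hs]
    have h := variance_fun_id_gaussianReal (μ := 0) (v := v)
    rw [variance_eq_integral (by fun_prop)] at h
    simpa using h

lemma norm_sub_le_spread (r : ℕ) (a : Fin M → Feature d) (k : Fin K) {i j : Fin M}
    (hi : i ∈ window M r k) (hj : j ∈ window M r k) : ‖a i - a j‖ ≤ spread r a k := by
  have h := Finset.le_sup (f := fun p : Fin M × Fin M => ‖a p.1 - a p.2‖₊)
    (Finset.mk_mem_product hi hj)
  exact_mod_cast h

lemma spread_nonneg (r : ℕ) (a : Fin M → Feature d) (k : Fin K) : 0 ≤ spread r a k :=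
  NNReal.coe_nonneg _

/-- The barycentre is a convex combination of points within `spread r a k` of `a m`. -/
lemma norm_sub_barycentre_le (r : ℕ) (a : Fin M → Feature d) (α : Fin K → Fin M → ℝ≥0) (k : Fin K)
    (hα : ∑ m ∈ window M r k, α k m = 1) {m : Fin M} (hm : m ∈ window M r k) :
    ‖a m - barycentre r α a k‖ ≤ spread r a k := by
  have hα' : ∑ m ∈ window M r k, (α k m : ℝ) = 1 := by exact_mod_cast hα
  have h : a m - barycentre r α a k = ∑ i ∈ window M r k, (α k i : ℝ) • (a m - a i) := by
    simp only [smul_sub, Finset.sum_sub_distrib, ← Finset.sum_smul, hα', one_smul, barycentre]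
  rw [h]
  refine (norm_sum_le _ _).trans ?_
  calc ∑ i ∈ window M r k, ‖(α k i : ℝ) • (a m - a i)‖
      ≤ ∑ i ∈ window M r k, (α k i : ℝ) * spread r a k := Finset.sum_le_sum fun i hi => by
        rw [norm_smul, NNReal.norm_eq]
        exact mul_le_mul_of_nonneg_left (norm_sub_le_spread r a k hm hi) (NNReal.coe_nonneg _)
    _ = spread r a k := by rw [← Finset.sum_mul, hα', one_mul]

lemma isProbabilityMeasure_clientLaw (r : ℕ) (α : Fin K → Fin M → ℝ≥0)
    (ν : Fin M → Measure (Sample d)) (hν : ∀ m, IsProbabilityMeasure (ν m)) (k : Fin K)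
    (hα : ∑ m ∈ window M r k, α k m = 1) : IsProbabilityMeasure (clientLaw r α ν k) := by
  constructor
  have h : ∑ m ∈ window M r k, (α k m : ℝ≥0∞) = 1 := by exact_mod_cast hα
  rw [clientLaw, Measure.finsetSum_apply]
  refine (Finset.sum_congr rfl fun m _ => ?_).trans h
  rw [Measure.smul_apply, measure_univ, ENNReal.smul_def, smul_eq_mul, mul_one]

/-- Second moment of the features of client `k` around the barycentre. -/
lemma clientLaw_second_moment (r : ℕ) (α : Fin K → Fin M → ℝ≥0) (a : Fin M → Feature d)
    (ν : Fin M → Measure (Sample d)) (hν : ∀ m, IsProbabilityMeasure (ν m)) (σ : ℝ)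
    (hfold : ∀ m, (ν m).map (fun z => ‖z.1 - a m‖) = foldedGaussian (Real.toNNReal (σ ^ 2)))
    (k : Fin K) (hα : ∑ m ∈ window M r k, α k m = 1) :
    Integrable (fun z : Sample d => ‖z.1 - barycentre r α a k‖ ^ 2) (clientLaw r α ν k) ∧
      ∫ z, ‖z.1 - barycentre r α a k‖ ^ 2 ∂(clientLaw r α ν k) ≤
        2 * (σ ^ 2 + spread r a k ^ 2) := by
  set b := barycentre r α a k
  have hα' : ∑ m ∈ window M r k, (α k m : ℝ) = 1 := by exact_mod_cast hα
  have hsq : ∀ m, Integrable (fun z : Sample d => ‖z.1 - a m‖ ^ 2) (ν m) ∧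
      ∫ z, ‖z.1 - a m‖ ^ 2 ∂(ν m) = σ ^ 2 := by
    intro m
    have hmeas : Measurable fun z : Sample d => ‖z.1 - a m‖ := by fun_prop
    have h := integrable_sq_foldedGaussian (Real.toNNReal (σ ^ 2))
    rw [← hfold m, Real.coe_toNNReal _ (sq_nonneg σ),
      integrable_map_measure (by fun_prop) hmeas.aemeasurable,
      integral_map hmeas.aemeasurable (by fun_prop)] at h
    exact h
  have hpt : ∀ m ∈ window M r k, ∀ z : Sample d,
      ‖z.1 - b‖ ^ 2 ≤ 2 * ‖z.1 - a m‖ ^ 2 + 2 * spread r a k ^ 2 := by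
    intro m hm z
    have h1 : ‖z.1 - b‖ ≤ ‖z.1 - a m‖ + spread r a k := by
      have := norm_add_le (z.1 - a m) (a m - b)
      rw [sub_add_sub_cancel] at this
      exact this.trans (by gcongr; exact norm_sub_barycentre_le r a α k hα hm)
    have h2 := pow_le_pow_left₀ (norm_nonneg _) h1 2
    nlinarith [sq_nonneg (‖z.1 - a m‖ - spread r a k)]
  have hdom : ∀ m, Integrable
      (fun z : Sample d => 2 * ‖z.1 - a m‖ ^ 2 + 2 * spread r a k ^ 2) (ν m) := fun m =>
    have := hν m
    ((hsq m).1.const_mul 2).add (integrable_const _)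
  have hint : ∀ m ∈ window M r k, Integrable (fun z : Sample d => ‖z.1 - b‖ ^ 2) (ν m) := by
    intro m hm
    refine (hdom m).mono' (by fun_prop) (Filter.Eventually.of_forall fun z => ?_)
    rw [Real.norm_eq_abs, abs_of_nonneg (by positivity)]
    exact hpt m hm z
  have hint' : ∀ m ∈ window M r k,
      Integrable (fun z : Sample d => ‖z.1 - b‖ ^ 2) (α k m • ν m) := fun m hm =>
    (hint m hm).smul_measure_nnreal
  refine ⟨integrable_finsetSum_measure.2 hint', ?_⟩
  rw [clientLaw, integral_finsetSum_measure hint']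
  calc ∑ m ∈ window M r k, ∫ z, ‖z.1 - b‖ ^ 2 ∂(α k m • ν m)
      ≤ ∑ m ∈ window M r k, (α k m : ℝ) * (2 * (σ ^ 2 + spread r a k ^ 2)) := by
        refine Finset.sum_le_sum fun m hm => ?_
        have := hν m
        rw [integral_smul_nnreal_measure, NNReal.smul_def, smul_eq_mul]
        refine mul_le_mul_of_nonneg_left ?_ (NNReal.coe_nonneg _)
        refine (integral_mono (hint m hm) (hdom m) (hpt m hm)).trans (le_of_eq ?_)
        rw [integral_add_const_of_prob ((hsq m).1.const_mul 2), integral_const_mul, (hsq m).2]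
        ring
    _ = _ := by rw [← Finset.sum_mul, hα', one_mul]

end Moments

/-! ### Numerical estimates -/

section Arithmetic

/-- If `3 x < 1` the floor is `0`. Otherwise `6 x + 1 ≤ 9 x ≤ (4 x) ^ 4`, and the fourth power
becomes the factor `4`. -/
lemma log_two_mul_floor_add_one_le {x y : ℝ} (hx : 0 ≤ x) (hxy : 4 * x ≤ y) :
    Real.log (2 * (⌊3 * x⌋₊ : ℝ) + 1) ≤ 4 * Real.log (max 1 y) := by
  have hmax : 0 ≤ Real.log (max 1 y) := Real.log_nonneg (le_max_left _ _)
  rcases lt_or_ge (3 * x) 1 with h | h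
  · rw [Nat.floor_eq_zero.2 h]
    simpa using hmax
  · have hfl := Nat.floor_le (show 0 ≤ 3 * x by linarith)
    rw [show 4 * Real.log (max 1 y) = Real.log (max 1 y ^ 4) by rw [Real.log_pow]; norm_num]
    refine Real.log_le_log (by positivity) ?_
    have h1 : (4 * x) ^ 4 ≤ max 1 y ^ 4 :=
      pow_le_pow_left₀ (by linarith) (hxy.trans (le_max_right _ _)) 4
    have h2 : (1 / 3 : ℝ) ^ 3 ≤ x ^ 3 := pow_le_pow_left₀ (by norm_num) (by linarith) 3
    nlinarith

/-- As `L ≥ 1 / 2`, the square is at least `D² + σ² / 2`; with `l L ≥ 1 / 2` this gives a factor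
`4`, rounded up to `5`. -/
lemma variance_proxy_le {D σ L l : ℝ} (hD : 0 ≤ D) (hσ : 0 ≤ σ) (hL : 1 / 2 ≤ L) (hl : 1 ≤ l) :
    σ ^ 2 + D ^ 2 ≤ 5 * ((D + σ * Real.sqrt L) ^ 2 * l * L) := by
  have h1 := Real.sq_sqrt (show 0 ≤ L by linarith)
  have h2 := Real.sqrt_nonneg L
  have h3 : D ^ 2 + σ ^ 2 / 2 ≤ (D + σ * Real.sqrt L) ^ 2 := by
    have : 0 ≤ D * (σ * Real.sqrt L) := by positivity
    have h4 : σ ^ 2 * (1 / 2) ≤ σ ^ 2 * L := mul_le_mul_of_nonneg_left hL (sq_nonneg σ)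
    nlinarith
  have h5 : (1 / 2 : ℝ) ≤ l * L := by nlinarith
  have h6 : (D ^ 2 + σ ^ 2 / 2) * (1 / 2) ≤ (D + σ * Real.sqrt L) ^ 2 * (l * L) := by
    gcongr
  nlinarith [sq_nonneg D, sq_nonneg σ]

lemma one_le_log_max_three (x : ℝ) : 1 ≤ Real.log (max 3 x) := by
  rw [Real.le_log_iff_exp_le (by positivity)]
  exact (Real.exp_one_lt_d9.le.trans (by norm_num)).trans (le_max_left _ _)

/-- Collecting the two parts of the bound for one client. -/
lemma client_bound_le {n : ℕ} (hn : 0 < n) {θ κ V ℓ X : ℝ} (hθ : 0 < θ)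
    (hV : κ ^ 2 * V ≤ 10 * X * θ ^ 2) (hℓ : ℓ ≤ 4 * X) (hX : 0 ≤ X) :
    2 / n * (3 / θ * Real.sqrt (n * (κ ^ 2 * V)) + Real.sqrt (2 * n * ℓ)) ≤
      30 * Real.sqrt (X / n) := by
  have hn' : (0 : ℝ) < n := by exact_mod_cast hn
  set S := Real.sqrt (X / n) with hS
  have hS2 : S ^ 2 = X / n := Real.sq_sqrt (by positivity)
  have hS0 : 0 ≤ S := Real.sqrt_nonneg _
  have hXS : X = n * S ^ 2 := by rw [hS2]; field_simp
  -- With `√10 ≤ 4` here and `√8 ≤ 3` in `h2`, the total is `2 * (3 * 4 + 3) = 30`.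
  have h1 : Real.sqrt (n * (κ ^ 2 * V)) ≤ 4 * n * S * θ := by
    refine Real.sqrt_le_iff.2 ⟨by positivity, ?_⟩
    calc n * (κ ^ 2 * V) ≤ n * (10 * X * θ ^ 2) := by gcongr
      _ = 10 * (n * S * θ) ^ 2 := by rw [hXS]; ring
      _ ≤ 16 * (n * S * θ) ^ 2 := by gcongr; norm_num
      _ = _ := by ring
  have h2 : Real.sqrt (2 * n * ℓ) ≤ 3 * n * S := by
    refine Real.sqrt_le_iff.2 ⟨by positivity, ?_⟩
    calc 2 * n * ℓ ≤ 2 * n * (4 * X) := by gcongr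
      _ = 8 * (n * S) ^ 2 := by rw [hXS]; ring
      _ ≤ 9 * (n * S) ^ 2 := by gcongr; norm_num
      _ = _ := by ring
  calc _ ≤ 2 / n * (3 / θ * (4 * n * S * θ) + 3 * n * S) := by gcongr
    _ = 30 * S := by field_simp; ring

/-- Cauchy–Schwarz against the constant vector. -/
lemma mean_sqrt_le {K : ℕ} (hK : 0 < K) (f : Fin K → ℝ) (hf : ∀ k, 0 ≤ f k) :
    1 / (K : ℝ) * ∑ k, Real.sqrt (f k) ≤ Real.sqrt (1 / (K : ℝ) * ∑ k, f k) := by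
  have hK' : (0 : ℝ) < K := by exact_mod_cast hK
  refine Real.le_sqrt_of_sq_le ?_
  have h := sq_sum_le_card_mul_sum_sq (s := Finset.univ) (f := fun k => Real.sqrt (f k))
  simp only [Real.sq_sqrt (hf _), Finset.card_univ, Fintype.card_fin] at h
  calc _ = (1 / (K : ℝ)) ^ 2 * (∑ k, Real.sqrt (f k)) ^ 2 := by ring
    _ ≤ (1 / (K : ℝ)) ^ 2 * (K * ∑ k, f k) := by gcongr
    _ = _ := by field_simp

end Arithmetic

end DSVM

/-! ### Assembling the bound -/

theorem theorem10 :
    ∃ C : ℝ, 0 < C ∧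
      ∀ (d n K M r : ℕ), 2 ≤ n * K → M ≤ K → 1 ≤ r → r ≤ M →
      ∀ (θ σ : ℝ), 0 < θ → θ ≤ 1 → 0 < σ →
      ∀ (a : Fin M → DSVM.Feature d) (ν : Fin M → Measure (DSVM.Sample d)),
        (∀ m, IsProbabilityMeasure (ν m)) →
        (∀ m, (ν m).map (fun z => ‖z.1 - a m‖) = DSVM.foldedGaussian (Real.toNNReal (σ ^ 2))) →
      ∀ (α : Fin K → Fin M → ℝ≥0),
        (∀ k, ∑ m ∈ DSVM.window M r k, α k m = 1) →
      ∀ (A : Fin K → Kernel (Fin n → DSVM.Sample d) (DSVM.Feature d)),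
        (∀ k, IsMarkovKernel (A k)) →
        (∀ k s, ∀ᵐ w ∂(A k s), ‖w‖ ≤ 1) →
        Integrable (DSVM.genError θ (DSVM.clientLaw r α ν))
            (DSVM.jointLaw (DSVM.clientLaw r α ν) A) ∧
        DSVM.expectedGenError θ (DSVM.clientLaw r α ν) A ≤
          C * Real.sqrt ((1 / ((n : ℝ) * K)) * ∑ k : Fin K,
            ((DSVM.effRadius n r a σ k / (K * θ)) ^ 2
                * Real.log (max 3 (K * θ / σ)) * Real.log ((n : ℝ) * K)
              + Real.log (max 1 (4 * n * ‖DSVM.barycentre r α a k‖ / (K * θ))))) := by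
  refine ⟨30, by norm_num, ?_⟩
  intro d n K M r hnK _ _ _ θ σ hθ _ hσ a ν hν hfold α hα A hA hAw
  have hn : 0 < n := Nat.pos_of_ne_zero (by rintro rfl; simp at hnK)
  have hK : 0 < K := Nat.pos_of_ne_zero (by rintro rfl; simp at hnK)
  have hn' : (1 : ℝ) ≤ n := by exact_mod_cast hn
  have hK' : (0 : ℝ) < K := by exact_mod_cast hK
  have hprob := fun k => DSVM.isProbabilityMeasure_clientLaw r α ν hν k (hα k)
  have hint := fun k => DSVM.integrable_clientError (n := n) θ (DSVM.clientLaw r α ν k) k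
    (DSVM.jointLaw (DSVM.clientLaw r α ν) A)
  have hgen : DSVM.genError (n := n) θ (DSVM.clientLaw r α ν) =
      fun ω => 1 / (K : ℝ) * ∑ k, DSVM.clientError θ (DSVM.clientLaw r α ν k) k ω := rfl
  refine ⟨hgen ▸ (integrable_finsetSum _ fun k _ => hint k).const_mul _, ?_⟩
  rw [DSVM.expectedGenError, hgen, integral_const_mul, integral_finsetSum _ fun k _ => hint k]
  have hL : 1 / 2 ≤ Real.log ((n : ℝ) * K) := by
    have h2 : (2 : ℝ) ≤ n * K := by exact_mod_cast hnK
    have h3 := Real.log_le_log (by norm_num) h2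
    linarith [Real.log_two_gt_d9]
  set l := Real.log (max 3 (K * θ / σ)) with hl
  have hl1 : 1 ≤ l := DSVM.one_le_log_max_three _
  set X : Fin K → ℝ := fun k => (DSVM.effRadius n r a σ k / (K * θ)) ^ 2 * l *
    Real.log ((n : ℝ) * K) + Real.log (max 1 (4 * n * ‖DSVM.barycentre r α a k‖ / (K * θ))) with hX
  have hX1 : ∀ k : Fin K, 0 ≤ (DSVM.effRadius n r a σ k / (K * θ)) ^ 2 * l * Real.log ((n : ℝ) * K) :=
    fun k => mul_nonneg (mul_nonneg (sq_nonneg _) (by linarith)) (by linarith)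
  have hX2 : ∀ k : Fin K, 0 ≤ Real.log (max 1 (4 * n * ‖DSVM.barycentre r α a k‖ / (K * θ))) :=
    fun k => Real.log_nonneg (le_max_left _ _)
  have hX0 : ∀ k, 0 ≤ X k := fun k => add_nonneg (hX1 k) (hX2 k)
  have hclient : ∀ k, ∫ ω, DSVM.clientError θ (DSVM.clientLaw r α ν k) k ω
      ∂(DSVM.jointLaw (DSVM.clientLaw r α ν) A) ≤ 30 * Real.sqrt (X k / n) := by
    intro k
    set b := DSVM.barycentre r α a k
    set D := DSVM.spread r a k
    have hmom := DSVM.clientLaw_second_moment r α a ν hν σ hfold k (hα k)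
    -- The weight `1 / K` of one classifier gives the factor `1 / K ^ 2`; the nonnegative grid term
    -- of `X k` is added for free.
    have hproxy : (1 / (K : ℝ)) ^ 2 * (2 * (σ ^ 2 + D ^ 2)) ≤ 10 * X k * θ ^ 2 := by
      have h1 := DSVM.variance_proxy_le (DSVM.spread_nonneg r a k) hσ.le hL hl1
      calc (1 / (K : ℝ)) ^ 2 * (2 * (σ ^ 2 + D ^ 2))
          ≤ (1 / (K : ℝ)) ^ 2 * (2 * (5 * ((D + σ * Real.sqrt (Real.log ((n : ℝ) * K))) ^ 2 * l *
            Real.log ((n : ℝ) * K)))) := by gcongr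
        _ = 10 * ((DSVM.effRadius n r a σ k / (K * θ)) ^ 2 * l * Real.log ((n : ℝ) * K)) *
            θ ^ 2 := by rw [DSVM.effRadius]; field_simp; ring
        _ ≤ 10 * X k * θ ^ 2 := by
          have := hX2 k
          gcongr
          exact le_add_of_nonneg_right this
    have hlog : Real.log (2 * (⌊1 / (K : ℝ) * ‖b‖ / (θ / 3)⌋₊ : ℝ) + 1) ≤ 4 * X k := by
      -- The grid step `θ / 3` accounts for the `3` inside the floor, and `n ≥ 1` gives `4 x ≤ y`.
      have h1 := DSVM.log_two_mul_floor_add_one_le (x := ‖b‖ / (K * θ))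
        (y := 4 * n * ‖b‖ / (K * θ)) (by positivity) (by
          rw [mul_div_assoc, mul_assoc]
          have : 0 ≤ ‖b‖ / (K * θ) := by positivity
          nlinarith)
      rw [show 1 / (K : ℝ) * ‖b‖ / (θ / 3) = 3 * (‖b‖ / (K * θ)) by field_simp]
      linarith [hX1 k]
    refine DSVM.integral_clientError_le θ (DSVM.clientLaw r α ν) A hAw k fun v => ?_
    obtain ⟨H, hHi, hH, hHB⟩ := DSVM.exists_uniform_bound hn (DSVM.clientLaw r α ν k) b v
      (κ := 1 / (K : ℝ)) (by positivity) hθ (V := 2 * (σ ^ 2 + D ^ 2)) (by positivity)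
      hmom.1 hmom.2
    exact ⟨H, hHi, hH, hHB.trans (DSVM.client_bound_le hn hθ hproxy hlog (hX0 k))⟩
  calc 1 / (K : ℝ) * ∑ k, ∫ ω, DSVM.clientError θ (DSVM.clientLaw r α ν k) k ω
        ∂(DSVM.jointLaw (DSVM.clientLaw r α ν) A)
      ≤ 1 / (K : ℝ) * ∑ k, 30 * Real.sqrt (X k / n) := by
        gcongr with k
        exact hclient k
    _ = 30 * (1 / (K : ℝ) * ∑ k, Real.sqrt (X k / n)) := by rw [← Finset.mul_sum]; ring
    _ ≤ 30 * Real.sqrt (1 / (K : ℝ) * ∑ k, X k / n) := by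
        gcongr
        exact DSVM.mean_sqrt_le hK _ fun k => div_nonneg (hX0 k) (by linarith)
    _ = 30 * Real.sqrt (1 / ((n : ℝ) * K) * ∑ k, X k) := by
        rw [← Finset.sum_div]
        congr 2
        field_simp
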